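/- A *quadratic set* is a pair $(X,r)$ with $X$ a nonempty set and $r\colon X\times X\to X\times X$ a bijection; write $r(x,y)=(\sigma_x(y),\gamma_y(x))$. It is *non-degenerate* if all maps $\sigma_x$ and $\gamma_x$ are bijective, *square-free* if $r(x,x)=(x,x)$ for all $x\in X$, and a *braided set* if $r_1r_2r_1=r_2r_1r_2$ on $X^3$, where $r_1=r\times\mathrm{id}_X$ and $r_2=\mathrm{id}_X\times r$. The $r$-orbits are the orbits of the group $\langle r\rangle$ on $X^2$. The *derived solution* of a non-degenerate braided set $(X,r)$ is $(X,r')$ with $$r'(x,y)=\bigl(\gamma_x(\sigma_{\gamma_y^{-1}(x)}(y)),\,x\bigr).$$ For a field $K$, let $A(K,X,r)=K[M(X,r)]$ be the monoid algebra of the monoid $M(X,r)=\langle X\mid xy=\sigma_x(y)\gamma_y(x)\ (x,y\in X)\rangle$, and for $m\ge 0$ let $A(K,X,r)_m$ be the $K$-linear span of the products $x_1\cdots x_m$ with $x_1,\dots,x_m\in X$. Let $(X,r)$ be a finite square-free non-degenerate braided set with $|X|>1$ such that the number of $r$-orbits in $X^2$ is exactly $2|X|-1$. Then $|X|$ is a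 prime number. Furthermore, the derived solution $(X,r')$ is, up to isomorphism, one of the following: 1. $|X|$ is an odd prime and $(X,r')$ is the braided set associated to the dihedral quandle of order $|X|$, that is, $\mathbb{Z}/(|X|)$ with the map $(i,j)\mapsto(2i-j,\,i)$; 2. $|X|=2$ and $(X,r')$ is the trivial braided set, that is, $r'(x,y)=(y,x)$ for all $x,y\in X$; 3. $X=\{1,2,3\}$ and $r'(x,y)=(\sigma'_x(y),x)$ with $\sigma'_1=\sigma'_2=\mathrm{id}$ and $\sigma'_3=(1,2)$. Moreover, $\dim_K A(K,X,r)_m=\dim_K A(K,X,r')_m$ for every nonnegative integer $m$ and every field $K$. -/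

import Mathlib

universe u v

namespace QuadraticSet

variable {X : Type u}

/-- For a quadratic set `(X, r)` (a bijection `r` of `X × X`) we write
`r (x, y) = (σ_x y, γ_y x)`; `sigma r x y` is `σ_x y`. -/
def sigma (r : Equiv.Perm (X × X)) (x y : X) : X := (r (x, y)).1

/-- `gamma r y x` is `γ_y x`, where `r (x, y) = (σ_x y, γ_y x)`. -/
def gamma (r : Equiv.Perm (X × X)) (y x : X) : X := (r (x, y)).2

/-- `(X, r)` is non-degenerate if all the maps `σ_x` and `γ_x` are bijective. -/
def IsNondegenerate (r : Equiv.Perm (X × X)) : Prop :=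
  (∀ x, Function.Bijective (sigma r x)) ∧ ∀ x, Function.Bijective (gamma r x)

/-- `(X, r)` is square-free if `r (x, x) = (x, x)` for all `x`. -/
def IsSquareFree (r : Equiv.Perm (X × X)) : Prop := ∀ x, r (x, x) = (x, x)

/-- The map `r × id` on `X³`. -/
def r₁ (r : Equiv.Perm (X × X)) (t : X × X × X) : X × X × X :=
  ((r (t.1, t.2.1)).1, (r (t.1, t.2.1)).2, t.2.2)

/-- The map `id × r` on `X³`. -/
def r₂ (r : Equiv.Perm (X × X)) (t : X × X × X) : X × X × X := (t.1, r t.2)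

/-- `(X, r)` is a braided set if `r₁ r₂ r₁ = r₂ r₁ r₂`. -/
def IsBraided (r : Equiv.Perm (X × X)) : Prop :=
  r₁ r ∘ r₂ r ∘ r₁ r = r₂ r ∘ r₁ r ∘ r₂ r

/-- The number of `r`-orbits, i.e. of orbits of the group `⟨r⟩` on `X × X`. -/
noncomputable def numOrbits (r : Equiv.Perm (X × X)) : ℕ :=
  Nat.card (MulAction.orbitRel.Quotient (Subgroup.zpowers r) (X × X))

/-- Isomorphism of quadratic sets. -/
def Iso {Y : Type v} (r : Equiv.Perm (X × X)) (s : Equiv.Perm (Y × Y)) : Prop :=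
  ∃ f : X ≃ Y, ∀ x y, s (f x, f y) = Prod.map f f (r (x, y))

/-- The inverse of the bijection `γ_y` of a non-degenerate quadratic set. -/
noncomputable def gammaInv (r : Equiv.Perm (X × X)) (h : IsNondegenerate r) (y : X) : X → X :=
  (Equiv.ofBijective (gamma r y) (h.2 y)).symm

/-- The map `(x, y) ↦ (γ_x (σ_{γ_y⁻¹ x} y), x)`. -/
noncomputable def derivedMap (r : Equiv.Perm (X × X)) (h : IsNondegenerate r) (t : X × X) : X × X :=
  (gamma r t.1 (sigma r (gammaInv r h t.2 t.1) t.2), t.1)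

theorem gamma_gammaInv (r : Equiv.Perm (X × X)) (h : IsNondegenerate r) (y x : X) :
    gamma r y (gammaInv r h y x) = x :=
  (Equiv.ofBijective (gamma r y) (h.2 y)).apply_symm_apply x

theorem derivedMap_bijective (r : Equiv.Perm (X × X)) (h : IsNondegenerate r) :
    Function.Bijective (derivedMap r h) := by
  constructor
  · rintro ⟨x, y⟩ ⟨x', y'⟩ e
    obtain ⟨e1, e2⟩ := Prod.mk.inj e
    dsimp only at e1 e2
    subst e2
    have e3 := (h.2 x).1 e1
    have e4 : r (gammaInv r h y x, y) = r (gammaInv r h y' x, y') :=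
      Prod.ext e3 ((gamma_gammaInv r h y x).trans (gamma_gammaInv r h y' x).symm)
    exact Prod.ext rfl (Prod.mk.inj (r.injective e4)).2
  · rintro ⟨a, x⟩
    obtain ⟨b, hb⟩ := (h.2 x).2 a
    obtain ⟨⟨z, y⟩, hz⟩ := r.surjective (b, x)
    have h1 : gamma r y z = x := congrArg Prod.snd hz
    have h2 : gammaInv r h y x = z := (h.2 y).1 ((gamma_gammaInv r h y x).trans h1.symm)
    have h3 : sigma r z y = b := congrArg Prod.fst hz
    refine ⟨(x, y), ?_⟩
    simp only [derivedMap, h2, h3, hb]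

/-- The derived solution `(X, r')`, `r' (x, y) = (γ_x (σ_{γ_y⁻¹ x} y), x)`. -/
noncomputable def derived (r : Equiv.Perm (X × X)) (h : IsNondegenerate r) :
    Equiv.Perm (X × X) :=
  Equiv.ofBijective (derivedMap r h) (derivedMap_bijective r h)

/-- The quadratic set `r (x, y) = (σ_x y, x)` given by a family of permutations `σ_x`. -/
def ofPerms (σ : X → Equiv.Perm X) : Equiv.Perm (X × X) where
  toFun t := (σ t.1 t.2, t.1)
  invFun t := (t.2, (σ t.2).symm t.1)
  left_inv t := by simp
  right_inv t := by simp

/-- The braided set `r (i, j) = (i ◃ j, i) = (2 i - j, i)` associated to the dihedral quandle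
of order `n`, whose underlying set is `ℤ/n`. -/
def dihedral (n : ℕ) : Equiv.Perm (Quandle.Dihedral n × Quandle.Dihedral n) :=
  ofPerms fun i => Rack.act' i

/-- The trivial braided set `r (x, y) = (y, x)`. -/
def trivialSet (X : Type u) : Equiv.Perm (X × X) := Equiv.prodComm X X

/-- The quadratic set on three points with `σ_0 = σ_1 = id` and `σ_2 = (0 1)`. -/
def threePoint : Equiv.Perm (Fin 3 × Fin 3) :=
  ofPerms ![1, 1, Equiv.swap 0 1]

/-- The defining relations `x y = σ_x(y) γ_y(x)` of the structure monoid. -/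
inductive StructureRel (r : Equiv.Perm (X × X)) : FreeMonoid X → FreeMonoid X → Prop
  | mk (x y : X) : StructureRel r (FreeMonoid.of x * FreeMonoid.of y)
      (FreeMonoid.of (sigma r x y) * FreeMonoid.of (gamma r y x))

/-- The structure monoid `M(X, r) = ⟨X ∣ x y = σ_x(y) γ_y(x)⟩`. -/
abbrev StructureMonoid (r : Equiv.Perm (X × X)) : Type u := PresentedMonoid (StructureRel r)

/-- The structure algebra `A(K, X, r) = K[M(X, r)]`. -/
abbrev StructureAlgebra (K : Type v) [Field K] (r : Equiv.Perm (X × X)) : Type (max u v) :=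
  MonoidAlgebra K (StructureMonoid r)

/-- The generator of the structure algebra given by `x ∈ X`. -/
noncomputable def gen (K : Type v) [Field K] (r : Equiv.Perm (X × X)) (x : X) :
    StructureAlgebra K r :=
  MonoidAlgebra.of K (StructureMonoid r) (PresentedMonoid.of (StructureRel r) x)

/-- The component `A_m`, the `K`-span of the products `x_1 ⋯ x_m` with `x_i ∈ X`. -/
noncomputable def component (K : Type v) [Field K] (r : Equiv.Perm (X × X)) (m : ℕ) :
    Submodule K (StructureAlgebra K r) :=
  Submodule.span K (Set.range fun w : Fin m → X => (List.ofFn fun i => gen K r (w i)).prod)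

end QuadraticSet

/-!
Write the derived solution as `r'(x, y) = (s x y, x)`, with permutations `s x = σ'_x`. The guitar
map `x_1 ⋯ x_m ↦ (γ_{x_m} ⋯ γ_{x_2} x_1) ⋯ (γ_{x_m} x_{m-1}) x_m` is a length-preserving bijection
of words which carries equality in the structure monoid of `r` to equality in that of `r'`. Hence
the two structure algebras have the same Hilbert series (`rank_component_derived`) and `r`, `r'`
have the same number of orbits on pairs. Moreover `x ◃ y = s x y` is a quandle operation, so that
what remains is the classification of the finite quandles with `2 |X| - 1` orbits of `(x, y) ↦ (x ◃
y, x)` on pairs.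

*Counting.* The product `s x * s y`, the unordered pair of the connected components of `x` and `y`
and, when `s x = s y`, the unordered pair `{x, y}` are invariants of an orbit. They separate the
`|X|` diagonal orbits and `|X| - 1` explicit orbits that depend on a choice of representatives
(`Representatives.pair_injective`). So these are all the orbits, for every choice.

*Disconnected quandles.* It follows that there are two components, joined by a single orbit of
pairs. The product `s x * s y` is constant on it, so `s` is constant on each component. A component
has at most two elements, and not both have two. This leaves the trivial and the three-point
solution.

*Connected quandles.* Let `Q` be the set of all permutations `s x`, a quandle under conjugation,
and put `n = |Q|`. The counting shows that every off-diagonal orbit of `Q` meets each first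
component. For `x ≠ y` this gives a cyclic enumeration `a : ZMod n ≃ Q` with `a 0 = y`, `a 1 = x`
and `a (k + 1) ◃ a k = a (k + 2)`. In particular an automorphism which fixes two points is trivial,
and Burnside's lemma bounds the number of fixed-point-free automorphisms by `n - 1`. On the other
hand the products `s x * s y` with `x` fixed and `y ≠ x`, which act as `a k ↦ a (k + 2)`, are `n -
1` such automorphisms. If `n` were even, an involution of the automorphism group would be one of
them, which forces `n = 4`, a case excluded by hand. If `n` is odd, the powers of one product `c`
also exhaust the fixed-point-free automorphisms. So `s x` normalizes `⟨c⟩`, and it acts on it by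
inversion: `Q` is dihedral (`IsMinimalQuandle.exists_equiv_zmod`), and `n` is prime because every
pair of distinct points generates `Q`. Finally `s` is injective (`injective_of_connected`), so that
`X` is isomorphic to `Q`.
-/

namespace QuadraticSet

/-! ### The derived solution and its quandle -/

section Derived

variable {X : Type u} {r : Equiv.Perm (X × X)}

theorem gammaInv_gamma (h : IsNondegenerate r) (y x : X) :
    gammaInv r h y (gamma r y x) = x :=
  (Equiv.ofBijective (gamma r y) (h.2 y)).symm_apply_apply x

theorem derived_apply (h : IsNondegenerate r) (x y : X) :
    derived r h (x, y) = (gamma r x (sigma r (gammaInv r h y x) y), x) := rfl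

/-- The maps `γ` define a right action of the structure monoid. -/
theorem gamma_gamma (hb : IsBraided r) (x y z : X) :
    gamma r z (gamma r y x) = gamma r (gamma r z y) (gamma r (sigma r y z) x) :=
  congrArg (fun t : X × X × X => t.2.2) (congrFun hb (x, y, z))

/-- The middle component of the braid relation. -/
theorem sigma_gamma (hb : IsBraided r) (x y z : X) :
    gamma r (sigma r (gamma r y x) z) (sigma r x y) =
      sigma r (gamma r (sigma r y z) x) (gamma r z y) :=
  congrArg (fun t : X × X × X => t.2.1) (congrFun hb (x, y, z))

/-- The map `(x, y) ↦ (γ_y x, y)` intertwines `r` with its derived solution. -/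
theorem derived_gamma (h : IsNondegenerate r) (x y : X) :
    derived r h (gamma r y x, y) =
      (gamma r (gamma r y x) (sigma r x y), gamma r y x) := by
  rw [derived_apply, gammaInv_gamma]

/-- Each `γ_z` is an automorphism of the derived solution. -/
theorem derived_map_gamma (hb : IsBraided r) (h : IsNondegenerate r) (z p q : X) :
    derived r h (gamma r z p, gamma r z q) = Prod.map (gamma r z) (gamma r z)
      (derived r h (p, q)) := by
  obtain ⟨x, rfl⟩ := (h.2 q).2 p
  rw [gamma_gamma hb x q z, derived_gamma, derived_gamma, ← sigma_gamma hb,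
    ← gamma_gamma hb x q z]
  refine Prod.ext ?_ rfl
  -- with `r (x, q) = (u, v)` this is the identity `γ_{γ_z v} γ_{σ_v z} u = γ_z γ_v u`
  exact (gamma_gamma hb (sigma r x q) (gamma r q x) z).symm

/-- The quandle operation `x ◃ y` of the derived solution. -/
noncomputable def derivedAct (r : Equiv.Perm (X × X)) (h : IsNondegenerate r) (x y : X) : X :=
  (derived r h (x, y)).1

theorem derived_eq (h : IsNondegenerate r) (x y : X) :
    derived r h (x, y) = (derivedAct r h x y, x) := rfl

theorem derivedAct_injective (h : IsNondegenerate r) (x : X) :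
    Function.Injective (derivedAct r h x) := by
  intro y y' e
  have : derived r h (x, y) = derived r h (x, y') := by rw [derived_eq, derived_eq, e]
  exact (Prod.mk.inj ((derived r h).injective this)).2

theorem derivedAct_self (h : IsNondegenerate r) (hsf : IsSquareFree r) (x : X) :
    derivedAct r h x x = x := by
  have hg : gamma r x x = x := congrArg Prod.snd (hsf x)
  have hs : sigma r x x = x := congrArg Prod.fst (hsf x)
  have := derived_gamma h x x
  rw [hg, hs, hg] at this
  exact congrArg Prod.fst this

theorem derivedAct_gamma (hb : IsBraided r) (h : IsNondegenerate r) (z x y : X) :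
    derivedAct r h (gamma r z x) (gamma r z y) = gamma r z (derivedAct r h x y) :=
  congrArg Prod.fst (derived_map_gamma hb h z x y)

theorem gamma_gamma_sigma (h : IsNondegenerate r) (x y : X) :
    gamma r (gamma r y x) (sigma r x y) = derivedAct r h (gamma r y x) y :=
  (congrArg Prod.fst (derived_gamma h x y)).symm

/-- The derived solution of a braided set is self-distributive.  This is the braid relation of `r`
transported along the bijection `(x, y, z) ↦ (γ_z γ_y x, γ_z y, z)`. -/
theorem derivedAct_derivedAct (hb : IsBraided r) (h : IsNondegenerate r) (a b c : X) :
    derivedAct r h a (derivedAct r h b c) =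
      derivedAct r h (derivedAct r h a b) (derivedAct r h a c) := by
  obtain ⟨y, rfl⟩ := (h.2 c).2 b
  obtain ⟨x', rfl⟩ := (h.2 c).2 a
  obtain ⟨x, rfl⟩ := (h.2 y).2 x'
  have hxyz : sigma r x (sigma r y c) = sigma r (sigma r x y) (sigma r (gamma r y x) c) :=
    (congrArg Prod.fst (congrFun hb (x, y, c))).symm
  -- both sides are a product of two maps `γ` applied to `σ_x σ_y c`
  have hl : derivedAct r h (gamma r c (gamma r y x)) (derivedAct r h (gamma r c y) c) =
      gamma r (gamma r c y) (gamma r (gamma r (sigma r y c) x) (sigma r x (sigma r y c))) := by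
    rw [← gamma_gamma_sigma h y c, gamma_gamma hb x y c, derivedAct_gamma hb,
      ← gamma_gamma_sigma h]
  have hr : derivedAct r h (derivedAct r h (gamma r c (gamma r y x)) (gamma r c y))
        (derivedAct r h (gamma r c (gamma r y x)) c) =
      gamma r (gamma r c (gamma r y x))
        (gamma r (gamma r (sigma r (gamma r y x) c) (sigma r x y))
          (sigma r (sigma r x y) (sigma r (gamma r y x) c))) := by
    rw [derivedAct_gamma hb, ← gamma_gamma_sigma h x y, ← gamma_gamma_sigma h (gamma r y x) c,
      gamma_gamma hb (sigma r x y) (gamma r y x) c, derivedAct_gamma hb, ← gamma_gamma_sigma h]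
  rw [hl, hr, hxyz, gamma_gamma hb _ (gamma r (sigma r y c) x) (gamma r c y), sigma_gamma hb,
    gamma_gamma hb x y c]

theorem orbitRel_zpowers_iff_sameCycle {α : Type*} (f : Equiv.Perm α) (p q : α) :
    MulAction.orbitRel (Subgroup.zpowers f) α p q ↔ f.SameCycle q p := by
  rw [MulAction.orbitRel_apply, MulAction.mem_orbit_iff]
  exact ⟨fun ⟨⟨_, k, rfl⟩, hg⟩ => ⟨k, hg⟩, fun ⟨k, hk⟩ => ⟨⟨_, k, rfl⟩, hk⟩⟩

/-- The number of orbits of a permutation, as a permutation group, is a conjugacy invariant. -/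
theorem numOrbits_eq_of_semiconj {s : Equiv.Perm (X × X)} (J : X × X ≃ X × X)
    (hJ : ∀ p, J (r p) = s (J p)) : numOrbits r = numOrbits s := by
  have e : s = J.permCongr r := by
    ext1 p
    simp [hJ]
  refine Nat.card_congr (Quotient.congr J fun p q => ?_)
  rw [orbitRel_zpowers_iff_sameCycle, orbitRel_zpowers_iff_sameCycle, e]
  have hz : ∀ k : ℤ, (J.permCongr r ^ k) (J q) = J ((r ^ k) q) := fun k => by
    rw [← Equiv.permCongrHom_coe, ← map_zpow]
    simp
  simp only [Equiv.Perm.SameCycle, hz, J.injective.eq_iff]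

theorem numOrbits_derived (h : IsNondegenerate r) :
    numOrbits (derived r h) = numOrbits r := by
  refine (numOrbits_eq_of_semiconj
    (Equiv.ofBijective (fun p : X × X => (gamma r p.2 p.1, p.2)) ⟨?_, ?_⟩) ?_).symm
  · rintro ⟨x, y⟩ ⟨x', y'⟩ e
    obtain ⟨e1, rfl⟩ := Prod.mk.inj e
    exact Prod.ext ((h.2 y).1 e1) rfl
  · rintro ⟨x, y⟩
    exact ⟨(gammaInv r h y x, y), Prod.ext (gamma_gammaInv r h y x) rfl⟩
  · rintro ⟨x, y⟩
    exact (derived_gamma h x y).symm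

end Derived

/-! ### The guitar map -/

section Guitar

variable {X : Type u} {r : Equiv.Perm (X × X)}

/-- The right action `x ↦ γ_{y_k} ⋯ γ_{y_1} x` of a word `y_1 ⋯ y_k`. -/
def wordGamma (r : Equiv.Perm (X × X)) (l : List X) (x : X) : X :=
  l.foldl (fun x y => gamma r y x) x

/-- The guitar map `x_1 ⋯ x_m ↦ (γ_{x_m} ⋯ γ_{x_2} x_1) ⋯ (γ_{x_m} x_{m-1}) x_m`, which
intertwines the braid group actions on words given by `r` and by its derived solution. -/
def guitar (r : Equiv.Perm (X × X)) : List X → List X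
  | [] => []
  | x :: l => wordGamma r l x :: guitar r l

theorem wordGamma_append (l l' : List X) (x : X) :
    wordGamma r (l ++ l') x = wordGamma r l' (wordGamma r l x) := List.foldl_append

theorem guitar_append (l l' : List X) :
    guitar r (l ++ l') = (guitar r l).map (wordGamma r l') ++ guitar r l' := by
  induction l with
  | nil => rfl
  | cons x l ih => simp [guitar, ih, wordGamma_append]

@[simp] theorem length_guitar (l : List X) : (guitar r l).length = l.length := by
  induction l with
  | nil => rfl
  | cons x l ih => simp [guitar, ih]

theorem wordGamma_bijective (h : IsNondegenerate r) (l : List X) :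
    Function.Bijective (wordGamma r l) := by
  induction l with
  | nil => exact Function.bijective_id
  | cons y l ih => exact ih.comp (h.2 y)

theorem guitar_injective (h : IsNondegenerate r) : Function.Injective (guitar r) := by
  intro l
  induction l with
  | nil =>
    intro l' e
    simpa using (congrArg List.length e).symm
  | cons x l ih =>
    rintro (_ | ⟨x', l'⟩) e
    · simp [guitar] at e
    · obtain ⟨e1, e2⟩ := List.cons.inj e
      obtain rfl := ih e2
      rw [(wordGamma_bijective h l).1 e1]

theorem guitar_surjective (h : IsNondegenerate r) : Function.Surjective (guitar r) := by
  intro l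
  induction l with
  | nil => exact ⟨[], rfl⟩
  | cons x l ih =>
    obtain ⟨l, rfl⟩ := ih
    obtain ⟨x, rfl⟩ := (wordGamma_bijective h l).2 x
    exact ⟨x :: l, rfl⟩

/-- `WordRel r l l'` says that the words `l` and `l'` are equal in the structure monoid. -/
def WordRel (r : Equiv.Perm (X × X)) (l l' : List X) : Prop :=
  conGen (StructureRel r) (FreeMonoid.ofList l) (FreeMonoid.ofList l')

theorem WordRel.refl (l : List X) : WordRel r l l := (conGen (StructureRel r)).refl _

theorem WordRel.symm {l l' : List X} (e : WordRel r l l') : WordRel r l' l :=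
  (conGen (StructureRel r)).symm e

theorem WordRel.trans {l l' l'' : List X} (e : WordRel r l l') (e' : WordRel r l' l'') :
    WordRel r l l'' :=
  (conGen (StructureRel r)).trans e e'

theorem WordRel.append {l l' k k' : List X} (e : WordRel r l l') (e' : WordRel r k k') :
    WordRel r (l ++ k) (l' ++ k') :=
  (conGen (StructureRel r)).mul e e'

theorem wordRel_pair (x y : X) : WordRel r [x, y] [sigma r x y, gamma r y x] :=
  ConGen.Rel.of _ _ (StructureRel.mk x y)

/-- Induction principle for equality of words in the structure monoid. -/
theorem WordRel.rec_on {P : List X → List X → Prop}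
    (pair : ∀ x y, P [x, y] [sigma r x y, gamma r y x]) (refl : ∀ l, P l l)
    (symm : ∀ {l l'}, P l l' → P l' l) (trans : ∀ {l l' l''}, P l l' → P l' l'' → P l l'')
    (append : ∀ {l l' k k'}, WordRel r l l' → WordRel r k k' → P l l' → P k k' →
      P (l ++ k) (l' ++ k'))
    {l l' : List X} (e : WordRel r l l') : P l l' := by
  have key : ∀ w w' : FreeMonoid X, ConGen.Rel (StructureRel r) w w' → P w.toList w'.toList := by
    intro w w' e
    induction e with
    | of _ _ h => obtain ⟨x, y⟩ := h; exact pair x y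
    | refl w => exact refl _
    | symm _ ih => exact symm ih
    | trans _ _ ih ih' => exact trans ih ih'
    | mul h h' ih ih' => exact append h h' ih ih'
  exact key _ _ e

theorem wordGamma_congr (hb : IsBraided r) {l l' : List X} (e : WordRel r l l') :
    wordGamma r l = wordGamma r l' := by
  refine WordRel.rec_on (P := fun l l' => wordGamma r l = wordGamma r l')
    (fun x y => ?_) (fun _ => rfl) Eq.symm Eq.trans (fun _ _ h1 h2 => ?_) e
  · ext1 z
    exact gamma_gamma hb z x y
  · ext1 z
    rw [wordGamma_append, wordGamma_append, h1, h2]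

/-- Automorphisms of a quadratic set preserve equality of words in the structure monoid. -/
theorem WordRel.map {g : X → X} (hg : ∀ x y, r (g x, g y) = Prod.map g g (r (x, y)))
    {l l' : List X} (e : WordRel r l l') : WordRel r (l.map g) (l'.map g) := by
  refine WordRel.rec_on (P := fun l l' => WordRel r (l.map g) (l'.map g))
    (fun x y => ?_) (fun _ => .refl _) WordRel.symm WordRel.trans (fun _ _ h1 h2 => ?_) e
  · have h1 : sigma r (g x) (g y) = g (sigma r x y) := congrArg Prod.fst (hg x y)
    have h2 : gamma r (g y) (g x) = g (gamma r y x) := congrArg Prod.snd (hg x y)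
    have := wordRel_pair (r := r) (g x) (g y)
    rwa [h1, h2] at this
  · rw [List.map_append, List.map_append]
    exact h1.append h2

theorem derived_map_wordGamma (hb : IsBraided r) (h : IsNondegenerate r) (l : List X) (x y : X) :
    derived r h (wordGamma r l x, wordGamma r l y) =
      Prod.map (wordGamma r l) (wordGamma r l) (derived r h (x, y)) := by
  induction l generalizing x y with
  | nil => rfl
  | cons z l ih => exact (ih _ _).trans (congrArg _ (derived_map_gamma hb h z x y))

theorem guitar_pair (h : IsNondegenerate r) (x y : X) :
    guitar r [sigma r x y, gamma r y x] =
      [sigma (derived r h) (gamma r y x) y, gamma (derived r h) y (gamma r y x)] := by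
  change _ = [(derived r h (gamma r y x, y)).1, (derived r h (gamma r y x, y)).2]
  rw [derived_gamma]
  rfl

theorem WordRel.to_guitar (hb : IsBraided r) (h : IsNondegenerate r) {l l' : List X}
    (e : WordRel r l l') : WordRel (derived r h) (guitar r l) (guitar r l') := by
  refine WordRel.rec_on
    (P := fun l l' => WordRel (derived r h) (guitar r l) (guitar r l'))
    (fun x y => ?_) (fun _ => .refl _) WordRel.symm WordRel.trans (fun _ h' h1 h2 => ?_) e
  · rw [guitar_pair h]
    exact wordRel_pair _ _
  · rw [guitar_append, guitar_append, wordGamma_congr hb h']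
    exact (h1.map (derived_map_wordGamma hb h _)).append h2

/-- The guitar map reflects equality of words.  The induction needs the statement for all images
under automorphisms of the derived solution, since splitting a word changes the guitar map of its
left part by such an automorphism. -/
theorem WordRel.of_guitar (hb : IsBraided r) (h : IsNondegenerate r) {l l' : List X}
    (e : WordRel (derived r h) (guitar r l) (guitar r l')) :
    WordRel r l l' := by
  refine WordRel.rec_on (r := derived r h) (P := fun w w' => ∀ g : Equiv.Perm X,
    (∀ x y, derived r h (g x, g y) = Prod.map g g (derived r h (x, y))) →
    ∀ l l', guitar r l = w.map g → guitar r l' = w'.map g →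
      WordRel r l l') (fun x y g hg l l' hl hl' => ?_) (fun w g hg l l' hl hl' => ?_)
      (fun ih g hg l l' hl hl' => (ih g hg l' l hl' hl).symm)
      (fun {w w' w''} ih ih' g hg l l' hl hl' => ?_)
      (fun {w w' k k'} hw hk ih ih' g hg l l' hl hl' => ?_) e 1 (fun _ _ => rfl) l l'
      (List.map_id _).symm (List.map_id _).symm
  · obtain ⟨a, ha⟩ := (h.2 (g y)).2 (g x)
    have e1 : l = [a, g y] := guitar_injective h (by rw [hl]; simp [guitar, wordGamma, ha])
    have e2 : l' = [sigma r a (g y), gamma r (g y) a] := by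
      refine guitar_injective h ?_
      rw [hl', guitar_pair h, ha]
      change _ = [(derived r h (g x, g y)).1, (derived r h (g x, g y)).2]
      rw [hg]
      rfl
    rw [e1, e2]
    exact wordRel_pair _ _
  · rw [guitar_injective h (hl.trans hl'.symm)]
    exact .refl _
  · obtain ⟨k, hk⟩ := guitar_surjective h (w'.map g)
    exact (ih g hg l k hl hk).trans (ih' g hg k l' hk hl')
  · obtain ⟨q, hq⟩ := guitar_surjective h (k.map g)
    obtain ⟨q', hq'⟩ := guitar_surjective h (k'.map g)
    have hqq : WordRel r q q' := ih' g hg q q' hq hq'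
    -- the automorphism by which the guitar map of the left part is twisted
    let t : Equiv.Perm X := Equiv.ofBijective _ (wordGamma_bijective h q)
    have ht : ∀ x, t x = wordGamma r q x := fun _ => rfl
    have htd : ∀ x y, derived r h (t x, t y) = Prod.map t t (derived r h (x, y)) :=
      derived_map_wordGamma hb h q
    have hgt : ∀ x y, derived r h ((t⁻¹ * g) x, (t⁻¹ * g) y) =
        Prod.map ⇑(t⁻¹ * g) ⇑(t⁻¹ * g) (derived r h (x, y)) := by
      intro x y
      have h1 := htd (t⁻¹ (g x)) (t⁻¹ (g y))
      rw [show ∀ z, t (t⁻¹ z) = z from t.apply_symm_apply, show ∀ z, t (t⁻¹ z) = z from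
        t.apply_symm_apply, hg] at h1
      apply (t.injective.prodMap t.injective)
      rw [Equiv.Perm.mul_apply, Equiv.Perm.mul_apply, ← h1]
      ext <;> simp
    obtain ⟨p, hp⟩ := guitar_surjective h (w.map (t⁻¹ * g))
    obtain ⟨p', hp'⟩ := guitar_surjective h (w'.map (t⁻¹ * g))
    have hmap : ∀ v : List X, (v.map ⇑(t⁻¹ * g)).map (wordGamma r q) = v.map g := by
      intro v
      rw [List.map_map]
      refine List.map_congr_left fun x _ => ?_
      simp [← ht]
    have e1 : l = p ++ q := guitar_injective h (by
      rw [hl, guitar_append, hp, hq, hmap, List.map_append])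
    have e2 : l' = p' ++ q' := guitar_injective h (by
      rw [hl', guitar_append, ← wordGamma_congr hb hqq, hp', hq', hmap, List.map_append])
    rw [e1, e2]
    exact (ih _ hgt p p' hp hp').append hqq

end Guitar

/-! ### Hilbert series -/

section Rank

variable {X : Type u} {r : Equiv.Perm (X × X)} (K : Type v) [Field K]

theorem prod_gen_eq (l : List X) :
    (l.map (gen K r)).prod =
      MonoidAlgebra.of K (StructureMonoid r)
        (PresentedMonoid.mk (StructureRel r) (FreeMonoid.ofList l)) := by
  induction l with
  | nil => exact (map_one _).symm
  | cons x l ih =>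
    rw [List.map_cons, List.prod_cons, ih, gen, ← map_mul]
    rfl

theorem prod_gen_eq_iff (l l' : List X) :
    (l.map (gen K r)).prod = (l'.map (gen K r)).prod ↔ WordRel r l l' := by
  rw [prod_gen_eq, prod_gen_eq, MonoidAlgebra.of_injective.eq_iff]
  exact Quotient.eq

/-- The dimension of `A_m` is the number of elements of degree `m` of the structure monoid. -/
theorem rank_component (m : ℕ) :
    Module.rank K (component K r m) =
      Cardinal.mk (Set.range fun w : Fin m → X => ((List.ofFn w).map (gen K r)).prod) := by
  have e : (fun w : Fin m → X => (List.ofFn fun i => gen K r (w i)).prod) =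
      fun w => ((List.ofFn w).map (gen K r)).prod := by
    ext1 w
    rw [List.map_ofFn]
    rfl
  rw [component, e]
  have hB : LinearIndepOn K id (Set.range (MonoidAlgebra.of K (StructureMonoid r))) := by
    convert! (MonoidAlgebra.basis (StructureMonoid r) K).linearIndependent.linearIndepOn_id
  refine rank_span_set (hB.mono ?_)
  rintro _ ⟨w, rfl⟩
  exact ⟨_, (prod_gen_eq K _).symm⟩

/-- The structure algebras of a braided set and of its derived solution have the same Hilbert
series, because the guitar map is a length-preserving bijection which respects equality of words in
the structure monoids. -/
theorem rank_component_derived (hb : IsBraided r) (h : IsNondegenerate r) (m : ℕ) :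
    Module.rank K (component K r m) = Module.rank K (component K (derived r h) m) := by
  rw [rank_component, rank_component]
  have hl : ∀ w : Fin m → X, (guitar r (List.ofFn w)).length = m := by simp
  let F : (Fin m → X) → Fin m → X := fun w i => (guitar r (List.ofFn w)).get (i.cast (hl w).symm)
  have hF : ∀ w, List.ofFn (F w) = guitar r (List.ofFn w) := by
    intro w
    refine List.ext_get (by simp) fun i h1 h2 => by simp [F]
  have hiff : ∀ w w' : Fin m → X,
      ((List.ofFn w).map (gen K r)).prod = ((List.ofFn w').map (gen K r)).prod ↔
      ((List.ofFn (F w)).map (gen K (derived r h))).prod =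
        ((List.ofFn (F w')).map (gen K (derived r h))).prod := by
    intro w w'
    rw [prod_gen_eq_iff, prod_gen_eq_iff, hF, hF]
    exact ⟨fun e => e.to_guitar hb h, fun e => e.of_guitar hb h⟩
  have hFs : Function.Surjective F := by
    intro v
    obtain ⟨l, hlv⟩ := guitar_surjective h (List.ofFn v)
    have hlen : l.length = m := by
      rw [← length_guitar (r := r), hlv, List.length_ofFn]
    subst hlen
    refine ⟨l.get, List.ofFn_injective ?_⟩
    rw [hF, List.ofFn_get, hlv]
  refine Cardinal.mk_congr (Equiv.ofBijective (fun x => ⟨_, F x.2.choose, rfl⟩) ⟨?_, ?_⟩)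
  · intro x y e
    have := (hiff _ _).2 (congrArg Subtype.val e)
    exact Subtype.ext (x.2.choose_spec.symm.trans (this.trans y.2.choose_spec))
  · rintro ⟨_, v, rfl⟩
    obtain ⟨w, rfl⟩ := hFs v
    refine ⟨⟨_, w, rfl⟩, Subtype.ext ((hiff _ _).1 ?_)⟩
    exact Exists.choose_spec (p := fun w' : Fin m → X =>
      ((List.ofFn w').map (gen K r)).prod = ((List.ofFn w).map (gen K r)).prod) ⟨w, rfl⟩

end Rank

/-! ### Quandles all of whose orbits meet each first component -/

section Quandle

variable {Q : Type*}

/-- The family `s` of permutations is a quandle operation `x ◃ y = s x y`. -/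
structure IsQuandle (s : Q → Equiv.Perm Q) : Prop where
  act_self : ∀ x, s x x = x
  act_act : ∀ x y, s (s x y) = s x * s y * (s x)⁻¹

theorem ofPerms_apply (s : Q → Equiv.Perm Q) (x y : Q) : ofPerms s (x, y) = (s x y, x) := rfl

/-- A function which is invariant under a permutation is constant on its cycles. -/
theorem sameCycle_invariant {α β : Type*} {f : Equiv.Perm α} {F : α → β}
    (hF : ∀ p, F (f p) = F p) {p q : α} (h : f.SameCycle p q) : F p = F q := by
  obtain ⟨k, rfl⟩ := h
  induction k using Int.induction_on with
  | zero => rfl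
  | succ i ih => rw [add_comm, zpow_add, zpow_one, Equiv.Perm.mul_apply, hF, ih]
  | pred i ih =>
    rw [ih, ← hF ((f ^ (-(i : ℤ) - 1)) p), ← Equiv.Perm.mul_apply, ← zpow_one_add]
    congr 3
    ring

variable {s : Q → Equiv.Perm Q}

/-- The product `s x * s y` is constant on the orbits of `(x, y) ↦ (x ◃ y, x)`. -/
theorem IsQuandle.mul_eq_of_sameCycle (hs : IsQuandle s) {p q : Q × Q}
    (h : (ofPerms s).SameCycle p q) : s p.1 * s p.2 = s q.1 * s q.2 :=
  sameCycle_invariant (F := fun p : Q × Q => s p.1 * s p.2)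
    (fun p => by simp [ofPerms, hs.act_act]) h

/-- The minimality condition on the braided set of a quandle: every orbit off the diagonal contains
a pair with any prescribed first component. -/
def OrbitsCover (s : Q → Equiv.Perm Q) : Prop :=
  ∀ x y u, x ≠ y → ∃ v, (ofPerms s).SameCycle (x, y) (u, v)

theorem OrbitsCover.exists_enumeration [Finite Q] (hs : IsQuandle s) (hinj : Function.Injective s)
    (hc : OrbitsCover s) {x y : Q} (hxy : x ≠ y) :
    ∃ a : ZMod (Nat.card Q) ≃ Q, a 0 = y ∧ a 1 = x ∧ ∀ k, s (a (k + 1)) (a k) = a (k + 2) := by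
  set R := ofPerms s with hR
  let p : Q × Q := (x, y)
  have hsurj : Function.Surjective
      fun t : MulAction.orbit (Subgroup.zpowers R) p => t.1.1 := by
    intro u
    obtain ⟨v, k, hk⟩ := hc x y u hxy
    exact ⟨⟨(u, v), ⟨⟨R ^ k, k, rfl⟩, hk⟩⟩, rfl⟩
  have hmul : ∀ t : MulAction.orbit (Subgroup.zpowers R) p, s t.1.1 * s t.1.2 = s x * s y := by
    rintro ⟨_, ⟨⟨_, k, rfl⟩, rfl⟩⟩
    exact (hs.mul_eq_of_sameCycle (p := p) ⟨k, rfl⟩).symm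
  have hinj' : Function.Injective
      fun t : MulAction.orbit (Subgroup.zpowers R) p => t.1.1 := by
    intro t t' e
    have e' : t.1.1 = t'.1.1 := e
    have := (hmul t).trans (hmul t').symm
    rw [e', mul_right_inj, hinj.eq_iff] at this
    exact Subtype.ext (Prod.ext e' this)
  let b := (MulAction.orbitZPowersEquiv R p).symm.trans (Equiv.ofBijective _ ⟨hinj', hsurj⟩)
  have hb : ∀ k : ℤ, b k = ((R ^ k) p).1 := by
    intro k
    change ((MulAction.orbitZPowersEquiv R p).symm k).1.1 = _
    rw [MulAction.orbitZPowersEquiv_symm_apply']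
    rfl
  have hb' : ∀ k : ℤ, (R ^ k) p = (b k, b (k - 1)) := by
    intro k
    refine Prod.ext (hb k).symm ?_
    have h1 := hb (k - 1)
    rw [Int.cast_sub, Int.cast_one] at h1
    have h2 : (R ^ k) p = R ((R ^ (k - 1)) p) := by
      rw [← Equiv.Perm.mul_apply, ← zpow_one_add, add_sub_cancel]
    rw [h2, h1]
    rfl
  have hstep : ∀ k, b (k + 1) = s (b k) (b (k - 1)) := by
    intro k
    obtain ⟨k, rfl⟩ := ZMod.intCast_surjective k
    have h2 : (R ^ (k + 1)) p = R ((R ^ k) p) := by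
      rw [← Equiv.Perm.mul_apply, ← zpow_one_add, add_comm]
    have h3 := congrArg Prod.fst h2
    rw [hb' k, ← hb] at h3
    push_cast at h3
    exact h3
  have hp : p = (b 0, b (-1)) := by simpa using hb' 0
  have hcard : Nat.card Q = Function.minimalPeriod (R • ·) p := by
    rw [← Nat.card_congr b, Nat.card_zmod]
  rw [hcard]
  refine ⟨(Equiv.subRight 1).trans b, ?_, ?_, fun k => ?_⟩
  · simpa [p] using (congrArg Prod.snd hp).symm
  · simpa [p] using (congrArg Prod.fst hp).symm
  · have := hstep k
    simp only [Equiv.trans_apply, Equiv.subRight_apply, add_sub_cancel_right]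
    rw [← this]
    congr 1
    ring

/-- Distinct elements with the same action would commute, so that the orbit of their pair has only
two elements and cannot cover a third point. -/
theorem OrbitsCover.injective [Finite Q] (hs : IsQuandle s) (hc : OrbitsCover s)
    (hQ : 2 < Nat.card Q) : Function.Injective s := by
  intro x y e
  by_contra hxy
  have hx : s x y = y := by rw [e, hs.act_self]
  have hy : s y x = x := by rw [← e, hs.act_self]
  have hall : ∀ u, u = x ∨ u = y := by
    intro u
    obtain ⟨v, hv⟩ := hc x y u hxy
    have := sameCycle_invariant (f := ofPerms s) (F := fun p : Q × Q => p = (x, y) ∨ p = (y, x))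
      (fun p => ?_) hv
    · simp only [true_or, Prod.mk.injEq, eq_iff_iff, true_iff] at this
      tauto
    · have h1 : ofPerms s (x, y) = (y, x) := by rw [ofPerms_apply, hx]
      have h2 : ofPerms s (y, x) = (x, y) := by rw [ofPerms_apply, hy]
      have e1 : ofPerms s p = (x, y) ↔ p = (y, x) := by rw [← h2, (ofPerms s).injective.eq_iff]
      have e2 : ofPerms s p = (y, x) ↔ p = (x, y) := by rw [← h1, (ofPerms s).injective.eq_iff]
      rw [e1, e2, or_comm]
  have : Nat.card Q ≤ 2 := by
    have h : (Set.univ : Set Q) = {x, y} := by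
      ext u
      simpa using hall u
    rw [← Set.ncard_univ, h]
    exact (Set.ncard_insert_le x {y}).trans (by rw [Set.ncard_singleton])
  omega

/-- The automorphism group of a quandle. -/
def quandleAut (s : Q → Equiv.Perm Q) : Subgroup (Equiv.Perm Q) where
  carrier := {g | ∀ x, g * s x = s (g x) * g}
  one_mem' x := by simp
  mul_mem' {g g'} hg hg' x := by
    rw [mul_assoc, hg', ← mul_assoc, hg, mul_assoc]
    rfl
  inv_mem' {g} hg x := by
    have := hg (g⁻¹ x)
    rw [show g (g⁻¹ x) = x from g.apply_symm_apply x] at this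
    rw [inv_mul_eq_iff_eq_mul, ← mul_assoc, this, mul_assoc, mul_inv_cancel, mul_one]

theorem mem_quandleAut {g : Equiv.Perm Q} : g ∈ quandleAut s ↔ ∀ x, g * s x = s (g x) * g :=
  Iff.rfl

theorem quandleAut_apply {g : Equiv.Perm Q} (hg : g ∈ quandleAut s) (x y : Q) :
    g (s x y) = s (g x) (g y) :=
  congrArg (fun f : Equiv.Perm Q => f y) (hg x)

theorem IsQuandle.mem_quandleAut (hs : IsQuandle s) (x : Q) : s x ∈ quandleAut s := fun y => by
  rw [hs.act_act, inv_mul_cancel_right]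

theorem IsQuandle.closure_le (hs : IsQuandle s) :
    Subgroup.closure (Set.range s) ≤ quandleAut s := by
  rw [Subgroup.closure_le]
  rintro _ ⟨x, rfl⟩
  exact hs.mem_quandleAut x

/-- In a transitive permutation group of degree `n` in which only the identity fixes two points, at
most `n - 1` elements have no fixed point. -/
theorem card_fixedPointFree_lt [Finite Q] [Nonempty Q] (P : Subgroup (Equiv.Perm Q))
    (htr : ∀ x y : Q, ∃ g ∈ P, g x = y)
    (hfix : ∀ g ∈ P, ∀ x y, x ≠ y → g x = x → g y = y → g = 1) :
    {g | g ∈ P ∧ ∀ x, g x ≠ x}.ncard < Nat.card Q := by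
  classical
  have := Fintype.ofFinite Q
  have := Fintype.ofFinite P
  have hpre : MulAction.IsPretransitive P Q :=
    ⟨fun x y => let ⟨g, hg, e⟩ := htr x y; ⟨⟨g, hg⟩, e⟩⟩
  have hburn := MulAction.sum_card_fixedBy_eq_card_orbits_mul_card_group P Q
  have hone : Fintype.card (MulAction.orbitRel.Quotient P Q) = 1 := by
    obtain ⟨x⟩ := ‹Nonempty Q›
    refine Fintype.card_eq_one_iff.2 ⟨Quotient.mk'' x, fun y => ?_⟩
    have := (MulAction.pretransitive_iff_subsingleton_quotient P Q).1 hpre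
    exact Subsingleton.elim _ _
  rw [hone, one_mul] at hburn
  have hle : ∀ g : P, Fintype.card (MulAction.fixedBy Q g) +
      (if ∀ x, (g : Equiv.Perm Q) x ≠ x then 1 else 0) ≤
      1 + if g = 1 then Fintype.card Q - 1 else 0 := by
    intro g
    by_cases h1 : g = 1
    · have h2 := Fintype.card_subtype_le (fun x => x ∈ MulAction.fixedBy Q g)
      have h3 : 0 < Fintype.card Q := Fintype.card_pos
      obtain ⟨x⟩ := ‹Nonempty Q›
      rw [if_pos h1, if_neg (fun h => h x (by rw [h1]; rfl))]
      change Fintype.card {x // x ∈ MulAction.fixedBy Q g} + 0 ≤ _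
      omega
    · rw [if_neg h1, add_zero]
      split_ifs with h2
      · have : IsEmpty (MulAction.fixedBy Q g) := ⟨fun x => h2 x.1 x.2⟩
        simp
      · refine Fintype.card_le_one_iff.2 fun x y => ?_
        by_contra hxy
        exact h1 (Subtype.ext (hfix g g.2 x y (fun e => hxy (Subtype.ext e)) x.2 y.2))
  have hsum := Finset.sum_le_sum fun g (_ : g ∈ Finset.univ) => hle g
  rw [Finset.sum_add_distrib, Finset.sum_add_distrib, hburn] at hsum
  simp only [Finset.sum_const, Finset.card_univ, smul_eq_mul, mul_one, Finset.sum_ite_eq',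
    Finset.mem_univ, if_true, Finset.sum_boole, Nat.cast_id, add_le_add_iff_left] at hsum
  have hset : {g | g ∈ P ∧ ∀ x, g x ≠ x} = Subtype.val ''
      ((Finset.univ.filter fun g : P => ∀ x, (g : Equiv.Perm Q) x ≠ x : Finset P) : Set P) := by
    ext g
    simp [and_comm]
  rw [hset, Set.ncard_image_of_injective _ Subtype.val_injective, Set.ncard_coe_finset,
    Nat.card_eq_fintype_card]
  have h3 : 0 < Fintype.card Q := Fintype.card_pos
  omega

/-- A quandle with more than two points and a transitive automorphism group, all of whose
off-diagonal orbits meet each first component. -/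
structure IsMinimalQuandle (s : Q → Equiv.Perm Q) : Prop extends IsQuandle s where
  cover : OrbitsCover s
  transitive : ∀ x y : Q, ∃ g ∈ quandleAut s, g x = y
  two_lt : 2 < Nat.card Q

/-- A cyclic enumeration of `Q` with `a (k + 1) ◃ a k = a (k + 2)`. -/
def IsEnumeration {n : ℕ} (s : Q → Equiv.Perm Q) (a : ZMod n ≃ Q) : Prop :=
  ∀ k, s (a (k + 1)) (a k) = a (k + 2)

theorem IsEnumeration.mul_eq {n : ℕ} {a : ZMod n ≃ Q} (hs : IsQuandle s) (ha : IsEnumeration s a)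
    (k : ZMod n) : s (a (k + 1)) * s (a k) = s (a 1) * s (a 0) := by
  obtain ⟨k, rfl⟩ := ZMod.intCast_surjective k
  have step : ∀ k, s (a (k + 2)) * s (a (k + 1)) = s (a (k + 1)) * s (a k) := fun k => by
    rw [← ha, hs.act_act, inv_mul_cancel_right]
  induction k using Int.induction_on with
  | zero => simp
  | succ i ih =>
    rw [← ih, Int.cast_add, Int.cast_one, add_assoc, one_add_one_eq_two, step]
  | pred i ih =>
    rw [← ih, ← step]
    push_cast
    ring_nf

/-- The product of two consecutive terms of an enumeration shifts it by two. -/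
theorem IsEnumeration.mul_apply {n : ℕ} {a : ZMod n ≃ Q} (hs : IsQuandle s)
    (ha : IsEnumeration s a) (k : ZMod n) : (s (a 1) * s (a 0)) (a k) = a (k + 2) := by
  rw [← ha.mul_eq hs k, Equiv.Perm.mul_apply, hs.act_self, ha]

theorem IsEnumeration.pow_apply {n : ℕ} {a : ZMod n ≃ Q} (hs : IsQuandle s)
    (ha : IsEnumeration s a) (j : ℕ) (k : ZMod n) :
    ((s (a 1) * s (a 0)) ^ j) (a k) = a (k + 2 * j) := by
  induction j with
  | zero => simp
  | succ j ih =>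
    rw [pow_succ', Equiv.Perm.mul_apply, ih, ha.mul_apply hs]
    push_cast
    ring_nf

/-- An automorphism fixing two distinct points fixes the enumeration which they start. -/
theorem IsEnumeration.eq_one {n : ℕ} [NeZero n] {a : ZMod n ≃ Q} (ha : IsEnumeration s a)
    {g : Equiv.Perm Q} (hg : g ∈ quandleAut s) (h0 : g (a 0) = a 0) (h1 : g (a 1) = a 1) :
    g = 1 := by
  have key : ∀ k : ℕ, g (a k) = a k ∧ g (a (k + 1)) = a (k + 1) := by
    intro k
    induction k with
    | zero => simpa using ⟨h0, h1⟩
    | succ k ih =>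
      refine ⟨by simpa using ih.2, ?_⟩
      have := quandleAut_apply hg (a (k + 1)) (a k)
      rw [ih.1, ih.2, ha] at this
      rwa [Nat.cast_succ, add_assoc, one_add_one_eq_two]
  ext1 x
  obtain ⟨k, rfl⟩ := a.surjective x
  obtain ⟨k, rfl⟩ := ZMod.natCast_zmod_surjective k
  exact (key k).1

namespace IsMinimalQuandle

theorem injective [Finite Q] (h : IsMinimalQuandle s) : Function.Injective s :=
  h.cover.injective h.toIsQuandle h.two_lt

theorem exists_enumeration [Finite Q] (h : IsMinimalQuandle s) {x y : Q} (hxy : x ≠ y) :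
    ∃ a : ZMod (Nat.card Q) ≃ Q, a 0 = y ∧ a 1 = x ∧ IsEnumeration s a :=
  h.cover.exists_enumeration h.toIsQuandle h.injective hxy

theorem neZero_card (h : IsMinimalQuandle s) : NeZero (Nat.card Q) :=
  ⟨by have := h.two_lt; omega⟩

theorem ncard_fixedPointFree_lt [Finite Q] (h : IsMinimalQuandle s) :
    {g | g ∈ quandleAut s ∧ ∀ x, g x ≠ x}.ncard < Nat.card Q := by
  have := h.neZero_card
  have : Nonempty Q := (Nat.card_pos_iff.1 (Nat.pos_of_ne_zero (NeZero.ne (Nat.card Q)))).1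
  refine card_fixedPointFree_lt _ h.transitive fun g hg x y hxy hx hy => ?_
  obtain ⟨a, rfl, rfl, ha⟩ := h.exists_enumeration hxy
  exact ha.eq_one hg hy hx

theorem two_ne_zero (h : IsMinimalQuandle s) : (2 : ZMod (Nat.card Q)) ≠ 0 := by
  have h2 := h.two_lt
  intro e
  have := (ZMod.natCast_eq_zero_iff 2 (Nat.card Q)).1 (by exact_mod_cast e)
  have := Nat.le_of_dvd (by norm_num) this
  omega

theorem mul_mem_fixedPointFree [Finite Q] (h : IsMinimalQuandle s) {x y : Q} (hxy : x ≠ y) :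
    s x * s y ∈ {g | g ∈ quandleAut s ∧ ∀ x, g x ≠ x} := by
  refine ⟨mul_mem (h.mem_quandleAut x) (h.mem_quandleAut y), fun z => ?_⟩
  obtain ⟨a, rfl, rfl, ha⟩ := h.exists_enumeration hxy
  obtain ⟨k, rfl⟩ := a.surjective z
  rw [ha.mul_apply h.toIsQuandle, a.injective.ne_iff]
  simpa using h.two_ne_zero

/-- By counting, every fixed-point-free automorphism is a product `s x * s y`. -/
theorem exists_eq_mul [Finite Q] (h : IsMinimalQuandle s) {g : Equiv.Perm Q} (hg : g ∈ quandleAut s)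
    (hfix : ∀ x, g x ≠ x) (x : Q) : ∃ y, x ≠ y ∧ g = s x * s y := by
  have hsub : (fun y => s x * s y) '' {y | x ≠ y} ⊆
      {g | g ∈ quandleAut s ∧ ∀ x, g x ≠ x} := by
    rintro _ ⟨y, hy, rfl⟩
    exact h.mul_mem_fixedPointFree hy
  have hcard : ((fun y => s x * s y) '' {y | x ≠ y}).ncard = Nat.card Q - 1 := by
    rw [Set.ncard_image_of_injective _ fun y y' e => h.injective (mul_left_cancel e)]
    have : {y | x ≠ y} = Set.univ \ {x} := by
      ext y
      simp [eq_comm]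
    rw [this, Set.ncard_sdiff_singleton_of_mem (Set.mem_univ x), Set.ncard_univ]
  have heq := Set.eq_of_subset_of_ncard_le hsub
    (by have := h.ncard_fixedPointFree_lt; omega)
  obtain ⟨y, hy, e⟩ := heq.ge ⟨hg, hfix⟩
  exact ⟨y, hy, e.symm⟩

/-- The quandle cannot have four elements: the enumeration condition determines all translations as
`3`-cycles, and these are not compatible with self-distributivity. -/
theorem card_ne_four [Finite Q] (h : IsMinimalQuandle s) : Nat.card Q ≠ 4 := by
  intro h4
  have : Nontrivial Q := Finite.one_lt_card_iff_nontrivial.1 (by omega)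
  obtain ⟨x, y, hxy⟩ := exists_pair_ne Q
  obtain ⟨a, -, -, ha⟩ := h.exists_enumeration hxy
  clear hxy
  obtain ⟨n, hn⟩ : ∃ n, n = Nat.card Q := ⟨_, rfl⟩
  rw [← hn] at h4
  subst h4
  revert a
  rw [← hn]
  intro a ha
  have h3 : ∀ k, s (a k) (a (k + 3)) = a (k + 1) := fun k => by
    have := ha (k + 3)
    rwa [add_assoc, add_assoc, show (3 + 1 : ZMod 4) = 0 by decide,
      show (3 + 2 : ZMod 4) = 1 by decide, add_zero] at this
  have hz : ∀ k m : ZMod 4, m ≠ 0 → a (k + m) ≠ a k := fun k m hm e => by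
    have := a.injective e
    exact hm (by simpa using this)
  -- `s (a k)` fixes only `a k`, hence permutes the other three points cyclically
  have hfix : ∀ k m : ZMod 4, m ≠ 0 → s (a k) (a (k + m)) ≠ a (k + m) := by
    intro k m hm e
    obtain ⟨b, h0, h1, hb⟩ := h.exists_enumeration (hz k m hm)
    have := h.neZero_card
    have h1 := hb.eq_one (h.mem_quandleAut (a k)) (by rw [h0, h.act_self]) (by rw [h1, e])
    have h2 := h3 k
    rw [h1, Equiv.Perm.one_apply] at h2
    exact absurd (add_left_cancel (a.injective h2)) (by decide)
  have hinj : ∀ k m m' : ZMod 4, m ≠ m' → s (a k) (a (k + m)) ≠ s (a k) (a (k + m')) :=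
    fun k m m' hm e => hm (add_left_cancel (a.injective ((s (a k)).injective e)))
  have hval : ∀ k m : ZMod 4, ∃ j, s (a k) (a (k + m)) = a (k + j) := fun k m => by
    obtain ⟨j, hj⟩ := a.surjective (s (a k) (a (k + m)))
    exact ⟨j - k, by rw [← hj]; congr 1; ring⟩
  have key : ∀ k, s (a k) (a (k + 1)) = a (k + 2) ∧ s (a k) (a (k + 2)) = a (k + 3) := by
    intro k
    obtain ⟨j, hj⟩ := hval k 1
    obtain ⟨i, hi⟩ := hval k 2
    have a1 := hfix k 1 (by decide)
    have a2 := hfix k 2 (by decide)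
    have a3 := hinj k 1 0 (by decide)
    have a4 := hinj k 2 0 (by decide)
    have a5 := hinj k 1 3 (by decide)
    have a6 := hinj k 2 3 (by decide)
    have a7 := hinj k 1 2 (by decide)
    rw [h3] at a5 a6
    rw [add_zero, h.act_self] at a3 a4
    rw [hi, hj] at *
    have b : ∀ i : ZMod 4, i = 0 ∨ i = 1 ∨ i = 2 ∨ i = 3 := by decide
    rcases b i with rfl | rfl | rfl | rfl <;> rcases b j with rfl | rfl | rfl | rfl <;>
      simp_all
  have h5 := congrArg (fun f : Equiv.Perm Q => f (a 2)) (h.mem_quandleAut (a 0) (a 1))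
  have k0 := key 0
  have k1 := (key 1).1
  have h6 := (key 2).1
  have h7 := h3 0
  simp only [zero_add, one_add_one_eq_two, show (1 + 2 : ZMod 4) = 3 by decide,
    show (2 + 1 : ZMod 4) = 3 by decide, show (2 + 2 : ZMod 4) = 0 by decide] at *
  rw [Equiv.Perm.mul_apply, Equiv.Perm.mul_apply, k1, k0.1, k0.2, h6, h7] at h5
  exact absurd (a.injective h5) (by decide)

theorem odd_card [Finite Q] (h : IsMinimalQuandle s) : Odd (Nat.card Q) := by
  classical
  have := Fintype.ofFinite Q
  have h2 := h.two_lt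
  by_contra hodd
  have heven : Even (Nat.card Q) := by simpa using hodd
  have : Nontrivial Q := Finite.one_lt_card_iff_nontrivial.1 (by omega)
  obtain ⟨x, y, hxy⟩ := exists_pair_ne Q
  have hpre : MulAction.IsPretransitive (quandleAut s) Q :=
    ⟨fun x y => let ⟨g, hg, e⟩ := h.transitive x y; ⟨⟨g, hg⟩, e⟩⟩
  have hdvd : 2 ∣ Nat.card (quandleAut s) :=
    heven.two_dvd.trans (by
      have := MulAction.index_stabilizer_of_transitive (quandleAut s) x
      rw [← this]
      exact Subgroup.index_dvd_card _)
  have : Fact (Nat.Prime 2) := ⟨Nat.prime_two⟩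
  obtain ⟨⟨g, hg⟩, hord⟩ := exists_prime_orderOf_dvd_card' 2 hdvd
  rw [Subgroup.orderOf_mk] at hord
  have hg1 : g ≠ 1 := by
    rintro rfl
    simp at hord
  have hgg : g * g = 1 := by
    rw [← pow_two, ← hord, pow_orderOf_eq_one]
  -- a fixed point of the involution `g` would be unique, but `Q` has an even number of elements
  have hfix : ∀ z, g z ≠ z := by
    intro z hz
    let f : Function.End Q := ⇑g
    have hf : f ^ 2 ^ 1 = 1 := by
      rw [pow_one, pow_two]
      exact congrArg (fun f : Equiv.Perm Q => (f : Q → Q)) hgg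
    have hmod := Equiv.Perm.card_fixedPoints_modEq hf
    have hone : Fintype.card (Function.fixedPoints f) = 1 := by
      refine Fintype.card_eq_one_iff.2 ⟨⟨z, hz⟩, fun w => ?_⟩
      by_contra hne
      have hne' : w.1 ≠ z := fun e => hne (Subtype.ext e)
      obtain ⟨a, h0, h1, ha⟩ := h.exists_enumeration hne'
      have := h.neZero_card
      exact hg1 (ha.eq_one hg (by rw [h0]; exact hz) (by rw [h1]; exact w.2))
    rw [hone, ← Nat.card_eq_fintype_card] at hmod
    rw [Nat.even_iff] at heven
    rw [Nat.ModEq, heven] at hmod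
    norm_num at hmod
  obtain ⟨y', hxy', rfl⟩ := h.exists_eq_mul hg hfix x
  obtain ⟨a, rfl, rfl, ha⟩ := h.exists_enumeration hxy'
  have h4 : a 4 = a 0 := by
    have := congrArg (fun f : Equiv.Perm Q => f (a 0)) hgg
    simp only [Equiv.Perm.mul_apply (s (a 1) * s (a 0)), ha.mul_apply h.toIsQuandle,
      Equiv.Perm.one_apply] at this
    rw [← this]
    norm_num
  have h4' : (4 : ZMod (Nat.card Q)) = 0 := a.injective h4
  have hd := (ZMod.natCast_eq_zero_iff 4 (Nat.card Q)).1 (by exact_mod_cast h4')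
  have hle := Nat.le_of_dvd (by norm_num) hd
  have hne := h.card_ne_four
  obtain ⟨k, hk⟩ := heven
  omega

/-- A minimal quandle is a dihedral quandle. -/
theorem exists_equiv_zmod [Finite Q] (h : IsMinimalQuandle s) :
    ∃ f : Q ≃ ZMod (Nat.card Q), ∀ x y, f (s x y) = 2 * f x - f y := by
  have h2 := h.two_lt
  have : Nontrivial Q := Finite.one_lt_card_iff_nontrivial.1 (by omega)
  obtain ⟨x, y, hxy⟩ := exists_pair_ne Q
  obtain ⟨a, -, -, ha⟩ := h.exists_enumeration hxy
  generalize hn : Nat.card Q = n at a ha h2 ⊢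
  have : NeZero n := ⟨by omega⟩
  have hodd : Odd n := hn ▸ h.odd_card
  have hunit : IsUnit (2 : ZMod n) := by
    have := (ZMod.isUnit_iff_coprime 2 n).2 (Nat.coprime_two_left.2 hodd)
    exact_mod_cast this
  have hhalf : ∀ k : ZMod n, ∃ m : ℕ, 2 * (m : ZMod n) = k := fun k => by
    obtain ⟨u, hu⟩ := hunit.dvd (a := k)
    obtain ⟨m, rfl⟩ := ZMod.natCast_zmod_surjective u
    exact ⟨m, hu.symm⟩
  set c := s (a 1) * s (a 0) with hc
  have hpow : ∀ (j : ℕ) k, (c ^ j) (a k) = a (k + 2 * j) := ha.pow_apply h.toIsQuandle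
  have hcA : c ∈ quandleAut s := mul_mem (h.mem_quandleAut _) (h.mem_quandleAut _)
  -- the `n - 1` nontrivial powers of `c` exhaust the fixed-point-free automorphisms
  have hall : ∀ g ∈ quandleAut s, (∀ x, g x ≠ x) → ∃ t : ℕ, g = c ^ t := by
    intro g hg hfix
    have hsub : (fun j : ℕ => c ^ j) '' Set.Ioo 0 n ⊆ {g | g ∈ quandleAut s ∧ ∀ x, g x ≠ x} := by
      rintro _ ⟨j, hj, rfl⟩
      refine ⟨pow_mem hcA j, fun z hz => ?_⟩
      obtain ⟨k, rfl⟩ := a.surjective z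
      rw [hpow, a.injective.eq_iff, add_eq_left, hunit.mul_right_eq_zero,
        ZMod.natCast_eq_zero_iff] at hz
      exact absurd (Nat.le_of_dvd hj.1 hz) (not_le.2 hj.2)
    have hinj : Set.InjOn (fun j : ℕ => c ^ j) (Set.Ioo 0 n) := by
      intro i hi j hj e
      have e' := congrArg (fun f : Equiv.Perm Q => f (a 0)) e
      simp only [hpow, zero_add, a.injective.eq_iff, hunit.mul_right_inj] at e'
      rw [ZMod.natCast_eq_natCast_iff', Nat.mod_eq_of_lt hi.2, Nat.mod_eq_of_lt hj.2] at e'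
      exact e'
    have hcard : ((fun j : ℕ => c ^ j) '' Set.Ioo 0 n).ncard = n - 1 := by
      rw [hinj.ncard_image, ← Finset.coe_Ioo, Set.ncard_coe_finset, Nat.card_Ioo]
      rfl
    have heq := Set.eq_of_subset_of_ncard_le hsub
      (by have := h.ncard_fixedPointFree_lt; omega)
    obtain ⟨t, -, e⟩ := heq.ge ⟨hg, hfix⟩
    exact ⟨t, e.symm⟩
  have hs0 := h.mem_quandleAut (a 0)
  obtain ⟨t, ht⟩ := hall (s (a 0) * c * (s (a 0))⁻¹)
    (mul_mem (mul_mem hs0 hcA) (inv_mem hs0)) (fun x e => by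
      have e' : c ((s (a 0))⁻¹ x) = (s (a 0))⁻¹ x := by
        rw [Equiv.Perm.eq_inv_iff_eq]
        exact e
      obtain ⟨k, hk⟩ := a.surjective ((s (a 0))⁻¹ x)
      rw [← hk, ← pow_one c, hpow, a.injective.eq_iff, add_eq_left,
        hunit.mul_right_eq_zero, Nat.cast_one] at e'
      have : Fact (1 < n) := ⟨by omega⟩
      exact one_ne_zero e')
  have hconj : ∀ k : ℕ, s (a 0) (a (2 * k)) = a (2 * (t * k)) := by
    intro k
    have e1 : s (a 0) * c ^ k = c ^ (t * k) * s (a 0) := by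
      rw [pow_mul, ← ht, conj_pow, inv_mul_cancel_right]
    have e2 := congrArg (fun f : Equiv.Perm Q => f (a 0)) e1
    simp only [Equiv.Perm.mul_apply, hpow, h.act_self, zero_add] at e2
    rw [e2]
    push_cast
    rfl
  have hreflect : ∀ k, s (a 0) (a k) = a (-k) := by
    -- `a (-1) ◃ a 0 = a 1` forces `t = -1`
    have ht1 : (t : ZMod n) = -1 := by
      obtain ⟨m, hm⟩ := hhalf (-1)
      have e1 := hconj m
      have e2 := ha (-1)
      rw [neg_add_cancel, ← hm, e1, hm, a.injective.eq_iff] at e2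
      linear_combination -e2 + (t : ZMod n) * hm
    intro k
    obtain ⟨m, rfl⟩ := hhalf k
    rw [hconj, ht1]
    congr 1
    ring
  refine ⟨a.symm, fun x y => ?_⟩
  obtain ⟨j, rfl⟩ := a.surjective x
  obtain ⟨k, rfl⟩ := a.surjective y
  obtain ⟨m, rfl⟩ := hhalf j
  have e1 := quandleAut_apply (pow_mem hcA m) (a 0) (a (k - 2 * m))
  rw [hreflect, hpow, hpow, hpow] at e1
  simp only [zero_add, sub_add_cancel] at e1
  rw [← e1, a.symm_apply_apply, a.symm_apply_apply, a.symm_apply_apply]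
  ring

/-- The number of elements is prime, since otherwise the orbit of some pair would be confined to a
proper subgroup of the cyclic group. -/
theorem prime_card [Finite Q] (h : IsMinimalQuandle s) : (Nat.card Q).Prime := by
  have h2 := h.two_lt
  obtain ⟨f, hf⟩ := h.exists_equiv_zmod
  refine Nat.prime_def.2 ⟨by omega, fun d hd => ?_⟩
  by_contra! hne
  obtain ⟨e, he⟩ := hd
  have hd0 : (d : ZMod (Nat.card Q)) ≠ 0 := by
    rw [Ne, ZMod.natCast_eq_zero_iff]
    intro hdvd
    exact hne.2 (Nat.dvd_antisymm ⟨e, he⟩ hdvd)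
  have hxy : f.symm d ≠ f.symm 0 := f.symm.injective.ne hd0
  obtain ⟨a, h0, h1, ha⟩ := h.exists_enumeration hxy
  have key : ∀ k : ℕ, f (a k) = k * d ∧ f (a (k + 1)) = (k + 1) * d := by
    intro k
    induction k with
    | zero => simp [h0, h1]
    | succ k ih =>
      refine ⟨by simpa using ih.2, ?_⟩
      rw [Nat.cast_succ, add_assoc, one_add_one_eq_two, ← ha, hf, ih.1, ih.2]
      ring
  have h3 : a (e : ZMod (Nat.card Q)) = a 0 := by
    apply f.injective
    have := (key 0).1
    rw [Nat.cast_zero, zero_mul] at this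
    rw [this, (key e).1, ← Nat.cast_mul, mul_comm, ← he, ZMod.natCast_self]
  have h4 := (ZMod.natCast_eq_zero_iff _ _).1 (a.injective h3)
  have h5 : e ∣ Nat.card Q := ⟨d, by rw [he, mul_comm]⟩
  have h6 := Nat.dvd_antisymm h4 h5
  rw [← h6] at he
  have : 1 * Nat.card Q = d * Nat.card Q := by rw [one_mul]; exact he
  exact hne.1 (Nat.eq_of_mul_eq_mul_right (by omega) this).symm

end IsMinimalQuandle

end Quandle

/-! ### Counting orbits on pairs -/

section Counting

variable {X : Type*} {s : X → Equiv.Perm X}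

/-- The inner automorphism group of a quandle. -/
def innerGroup (s : X → Equiv.Perm X) : Subgroup (Equiv.Perm X) :=
  Subgroup.closure (Set.range s)

theorem mem_innerGroup (x : X) : s x ∈ innerGroup s :=
  Subgroup.subset_closure ⟨x, rfl⟩

/-- The connected component of a point, that is, its orbit under the inner automorphism group. -/
def connComp (s : X → Equiv.Perm X) (x : X) : MulAction.orbitRel.Quotient (innerGroup s) X :=
  Quotient.mk'' x

theorem connComp_eq_iff {x y : X} :
    connComp s x = connComp s y ↔ ∃ g ∈ innerGroup s, g y = x := by
  rw [connComp, connComp, Quotient.eq'', MulAction.orbitRel_apply, MulAction.mem_orbit_iff]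
  exact ⟨fun ⟨g, hg⟩ => ⟨g, g.2, hg⟩, fun ⟨g, hg, e⟩ => ⟨⟨g, hg⟩, e⟩⟩

theorem connComp_act (x y : X) : connComp s (s x y) = connComp s y :=
  connComp_eq_iff.2 ⟨s x, mem_innerGroup x, rfl⟩

theorem sameCycle_connComp {p q : X × X} (h : (ofPerms s).SameCycle p q) :
    s(connComp s p.1, connComp s p.2) = s(connComp s q.1, connComp s q.2) :=
  sameCycle_invariant (F := fun p : X × X => s(connComp s p.1, connComp s p.2))
    (fun p => by
      change s(connComp s (s p.1 p.2), connComp s p.1) = _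
      rw [connComp_act, Sym2.eq_swap]) h

/-- The orbit of a pair of elements with equal action contains only the two orderings of
the pair. -/
theorem IsQuandle.sameCycle_fiber (hs : IsQuandle s) {p q : X × X}
    (h : (ofPerms s).SameCycle p q) : (s p.1 = s p.2 ↔ s q.1 = s q.2) ∧
      (s p.1 = s p.2 → s(p.1, p.2) = s(q.1, q.2)) := by
  classical
  -- the invariant is the underlying unordered pair, or `none` if the actions differ
  have := sameCycle_invariant
    (F := fun p : X × X => if s p.1 = s p.2 then some s(p.1, p.2) else none) (fun p => ?_) h
  · split_ifs at this <;> simp_all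
  · obtain ⟨x, y⟩ := p
    have h1 : s (s x y) = s x ↔ s x = s y := by
      rw [hs.act_act, mul_inv_eq_iff_eq_mul, mul_right_inj, eq_comm]
    simp only [ofPerms_apply, h1]
    split_ifs with e
    · rw [e, hs.act_self, Sym2.eq_swap]
    · rfl

/-- Representatives `b` of the components and `ρ` of the sets of elements with equal action in the
same component, which are compatible with each other and with a base point. -/
structure Representatives (s : X → Equiv.Perm X) (x₀ : X) where
  /-- The representative of a component. -/
  b : X → X
  /-- The representative among the elements of a component with the same action. -/
  ρ : X → X
  connComp_b : ∀ x, connComp s (b x) = connComp s x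
  b_congr : ∀ x y, connComp s x = connComp s y → b x = b y
  b_base : b x₀ = x₀
  connComp_ρ : ∀ x, connComp s (ρ x) = connComp s x
  act_ρ : ∀ x, s (ρ x) = s x
  ρ_congr : ∀ x y, connComp s x = connComp s y → s x = s y → ρ x = ρ y
  ρ_b : ∀ x, ρ (b x) = b x

theorem nonempty_representatives (s : X → Equiv.Perm X) (x₀ : X) :
    Nonempty (Representatives s x₀) := by
  classical
  let b : X → X := fun x =>
    if connComp s x = connComp s x₀ then x₀ else Quotient.out (connComp s x)
  have hb : ∀ x, connComp s (b x) = connComp s x := fun x => by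
    by_cases h : connComp s x = connComp s x₀
    · simp [b, h]
    · simp only [b, if_neg h]
      exact Quotient.out_eq' _
  have hbc : ∀ x y, connComp s x = connComp s y → b x = b y := fun x y e => by
    simp only [b, e]
  have hbb : ∀ x, b (b x) = b x := fun x => hbc _ _ (hb x)
  let c : X → MulAction.orbitRel.Quotient (innerGroup s) X × Equiv.Perm X :=
    fun x => (connComp s x, s x)
  let ρ : X → X := fun x => if c x = c (b x) then b x else
    (show ∃ y, c y = c x from ⟨x, rfl⟩).choose
  have hρ : ∀ x, c (ρ x) = c x := fun x => by
    by_cases h : c x = c (b x)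
    · simp only [ρ, if_pos h, h]
    · simp only [ρ, if_neg h]
      exact (show ∃ y, c y = c x from ⟨x, rfl⟩).choose_spec
  refine ⟨⟨b, ρ, hb, hbc, by simp [b], fun x => congrArg Prod.fst (hρ x),
    fun x => congrArg Prod.snd (hρ x), fun x y h1 h2 => ?_, fun x => ?_⟩⟩
  · have hxy : c x = c y := Prod.ext h1 h2
    simp only [ρ, hxy, hbc x y h1]
  · simp only [ρ, hbb, if_true]

open Classical in
/-- A pair assigned to each `x ≠ x₀`: it joins `x` to the representative of its class, if `x` is a
class representative to that of its component, and if `x` is also a component representative to the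
base point. These pairs lie in distinct orbits. -/
noncomputable def Representatives.pair {x₀ : X} (B : Representatives s x₀) (x : X) : X × X :=
  if B.ρ x ≠ x then (x, B.ρ x) else if B.b x ≠ x then (B.b x, x) else (x₀, x)

theorem Representatives.pair_cases {x₀ : X} (B : Representatives s x₀) {x : X} (hx : x ≠ x₀) :
    (B.ρ x ≠ x ∧ B.pair x = (x, B.ρ x)) ∨
    (B.ρ x = x ∧ B.b x ≠ x ∧ s (B.b x) ≠ s x ∧ B.pair x = (B.b x, x)) ∨
    (B.ρ x = x ∧ B.b x = x ∧ connComp s x₀ ≠ connComp s x ∧ B.pair x = (x₀, x)) := by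
  by_cases h1 : B.ρ x ≠ x
  · exact .inl ⟨h1, if_pos h1⟩
  · rw [not_not] at h1
    by_cases h2 : B.b x ≠ x
    · refine .inr (.inl ⟨h1, h2, fun e => h2 ?_, by rw [pair, if_neg (not_not.2 h1), if_pos h2]⟩)
      have := B.ρ_congr _ _ (B.connComp_b x) e
      rwa [B.ρ_b, h1] at this
    · rw [not_not] at h2
      refine .inr (.inr ⟨h1, h2, fun e => hx ?_, by
        rw [pair, if_neg (not_not.2 h1), if_neg (not_not.2 h2)]⟩)
      have := B.b_congr _ _ e
      rw [B.b_base, h2] at this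
      exact this.symm

theorem Representatives.pair_fst_ne_snd {x₀ : X} (B : Representatives s x₀) {x : X} (hx : x ≠ x₀) :
    (B.pair x).1 ≠ (B.pair x).2 := by
  rcases B.pair_cases hx with ⟨h1, e⟩ | ⟨-, h2, -, e⟩ | ⟨-, -, -, e⟩ <;> rw [e]
  · exact h1.symm
  · exact h2
  · exact hx.symm

theorem sym2_same {α : Type*} {a b c : α} (h : s(a, a) = s(b, c)) : b = a ∧ c = a := by
  rw [Sym2.eq_iff] at h
  tauto

theorem sym2_left {α : Type*} {a b c : α} (h : s(a, b) = s(a, c)) : b = c :=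
  Sym2.congr_right.1 h

theorem Representatives.pair_injective (hs : IsQuandle s) {x₀ : X} (B : Representatives s x₀)
    {x y : X} (hx : x ≠ x₀) (hy : y ≠ x₀) (h : (ofPerms s).SameCycle (B.pair x) (B.pair y)) :
    x = y := by
  have i1 := hs.mul_eq_of_sameCycle h
  have i2 := sameCycle_connComp h
  have i3 := hs.sameCycle_fiber h
  rcases B.pair_cases hx with ⟨h1, e⟩ | ⟨h1, h2, h3, e⟩ | ⟨h1, h2, h3, e⟩ <;>
  rcases B.pair_cases hy with ⟨k1, f⟩ | ⟨k1, k2, k3, f⟩ | ⟨k1, k2, k3, f⟩ <;>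
  simp only [e, f, B.act_ρ, B.connComp_ρ, B.connComp_b] at i1 i2 i3
  · have := i3.2 trivial
    rw [Sym2.eq_iff] at this
    rcases this with h | ⟨h, h'⟩
    · exact h.1
    · have := B.ρ_congr y (B.ρ y) (B.connComp_ρ y).symm (B.act_ρ y).symm
      rw [← h, h'] at this
      exact absurd (h.symm.trans this) k1
  · exact absurd (i3.1.1 trivial) k3
  · have := sym2_same i2
    exact absurd (this.1.trans this.2.symm) k3
  · exact absurd (i3.1.2 trivial) h3
  · have hc := (sym2_same i2).1.symm
    rw [B.b_congr x y hc, mul_right_inj] at i1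
    rw [← h1, ← k1]
    exact B.ρ_congr _ _ hc i1
  · have := sym2_same i2
    exact absurd (this.1.trans this.2.symm) k3
  · have := sym2_same i2.symm
    exact absurd (this.1.trans this.2.symm) h3
  · have := sym2_same i2.symm
    exact absurd (this.1.trans this.2.symm) h3
  · rw [← h2, ← k2]
    exact B.b_congr _ _ (sym2_left i2)

/-- If there are `2 |X| - 1` orbits, then those of the pairs `(x, x)` and of the pairs
`B.pair x` for `x ≠ x₀` are all the orbits, for every choice of representatives. -/
theorem Representatives.exists_sameCycle [Finite X] (hs : IsQuandle s)
    (hcard : numOrbits (ofPerms s) = 2 * Nat.card X - 1) {x₀ : X} (B : Representatives s x₀)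
    {p : X × X} (hp : p.1 ≠ p.2) : ∃ x, x ≠ x₀ ∧ (ofPerms s).SameCycle p (B.pair x) := by
  let π : X × X → MulAction.orbitRel.Quotient (Subgroup.zpowers (ofPerms s)) (X × X) :=
    Quotient.mk''
  have hπ : ∀ p q, π p = π q ↔ (ofPerms s).SameCycle p q := fun p q => by
    rw [Quotient.eq'', orbitRel_zpowers_iff_sameCycle, Equiv.Perm.sameCycle_comm]
  have hdiag : ∀ x (q : X × X), (ofPerms s).SameCycle (x, x) q → q = (x, x) := by
    intro x q h
    have := sym2_same ((hs.sameCycle_fiber h).2 rfl)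
    exact Prod.ext this.1 this.2
  let Φ : X ⊕ {x // x ≠ x₀} →
      MulAction.orbitRel.Quotient (Subgroup.zpowers (ofPerms s)) (X × X) :=
    Sum.elim (fun x => π (x, x)) (fun x => π (B.pair x))
  have hΦ : Function.Injective Φ := by
    refine Function.Injective.sumElim (fun x y h => ?_) (fun x y h => ?_) (fun x y h => ?_)
    · exact (Prod.mk.inj (hdiag x _ ((hπ _ _).1 h))).1.symm
    · exact Subtype.ext (B.pair_injective hs x.2 y.2 ((hπ _ _).1 h))
    · have := hdiag x _ ((hπ _ _).1 h)
      exact B.pair_fst_ne_snd y.2 (by rw [this])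
  have hle : Nat.card (MulAction.orbitRel.Quotient (Subgroup.zpowers (ofPerms s)) (X × X)) ≤
      Nat.card (X ⊕ {x // x ≠ x₀}) := by
    have : Nat.card {x // x ≠ x₀} = Nat.card X - 1 := by
      change Nat.card ({x₀}ᶜ : Set X) = _
      rw [Nat.card_coe_set_eq, Set.ncard_compl, Set.ncard_singleton]
    rw [Nat.card_sum, this]
    change numOrbits _ ≤ _
    omega
  obtain ⟨x | x, hx⟩ := (hΦ.bijective_of_nat_card_le hle).2 (π p)
  · have := hdiag x _ ((hπ _ _).1 hx)
    exact absurd (by rw [this]) hp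
  · exact ⟨x, x.2, ((hπ _ _).1 hx).symm⟩

end Counting

/-! ### Connected quandles with few orbits -/

section Connected

variable {X : Type*} {s : X → Equiv.Perm X}

theorem innerGroup_le (hs : IsQuandle s) : innerGroup s ≤ quandleAut s := hs.closure_le

/-- In a connected quandle with `2 |X| - 1` orbits, the orbit of a pair with distinct actions
contains a pair `(x₀, z)` with `z` a representative. -/
theorem Representatives.exists_sameCycle_base [Finite X] (hs : IsQuandle s)
    (hcard : numOrbits (ofPerms s) = 2 * Nat.card X - 1)
    (hconn : ∀ x y, connComp s x = connComp s y) {x₀ : X} (B : Representatives s x₀)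
    {p : X × X} (hp : s p.1 ≠ s p.2) : ∃ z, B.ρ z = z ∧ (ofPerms s).SameCycle p (x₀, z) := by
  obtain ⟨z, hz, h⟩ := B.exists_sameCycle hs hcard (fun e => hp (congrArg s e))
  rcases B.pair_cases hz with ⟨-, e⟩ | ⟨h1, -, -, e⟩ | ⟨-, -, h3, -⟩
  · rw [e] at h
    exact absurd ((hs.sameCycle_fiber h).1.2 (B.act_ρ z).symm) hp
  · rw [e, B.b_congr z x₀ (hconn _ _), B.b_base] at h
    exact ⟨z, h1, h⟩
  · exact absurd (hconn _ _) h3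

theorem sameCycle_of_mul_eq [Finite X] (hs : IsQuandle s)
    (hcard : numOrbits (ofPerms s) = 2 * Nat.card X - 1)
    (hconn : ∀ x y, connComp s x = connComp s y) {p q : X × X} (hp : s p.1 ≠ s p.2)
    (hq : s q.1 ≠ s q.2) (hpq : s p.1 * s p.2 = s q.1 * s q.2) : (ofPerms s).SameCycle p q := by
  obtain ⟨B⟩ := nonempty_representatives s p.1
  obtain ⟨z, hz, h⟩ := B.exists_sameCycle_base hs hcard hconn hp
  obtain ⟨w, hw, k⟩ := B.exists_sameCycle_base hs hcard hconn hq
  have e : s p.1 * s z = s p.1 * s w :=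
    (hs.mul_eq_of_sameCycle h).symm.trans (hpq.trans (hs.mul_eq_of_sameCycle k))
  have := B.ρ_congr z w (hconn _ _) (mul_left_cancel e)
  rw [hz, hw] at this
  rw [this] at h
  exact h.trans k.symm

/-- Conjugation on the set of all permutations `s x`. It makes this set a quandle. -/
def imageAct (hs : IsQuandle s) (g : Set.range s) : Equiv.Perm (Set.range s) :=
  Equiv.Perm.subtypePerm (MulAut.conj (g : Equiv.Perm X)).toEquiv (p := (· ∈ Set.range s)) (by
    obtain ⟨_, x, rfl⟩ := g
    refine fun t => ⟨?_, ?_⟩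
    · rintro ⟨y, hy⟩
      refine ⟨(s x)⁻¹ y, ?_⟩
      have := hs.act_act x ((s x)⁻¹ y)
      rw [show s x ((s x)⁻¹ y) = y from (s x).apply_symm_apply y, hy] at this
      exact ((MulAut.conj (s x)).injective this).symm
    · rintro ⟨y, rfl⟩
      exact ⟨s x y, hs.act_act x y⟩)

theorem imageAct_apply (hs : IsQuandle s) (x y : X) :
    imageAct hs (Set.rangeFactorization s x) (Set.rangeFactorization s y) =
      Set.rangeFactorization s (s x y) :=
  Subtype.ext (hs.act_act x y).symm

theorem isQuandle_imageAct (hs : IsQuandle s) : IsQuandle (imageAct hs) := by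
  have hsurj := Set.rangeFactorization_surjective (f := s)
  refine ⟨fun g => ?_, fun g g' => ?_⟩
  · obtain ⟨x, rfl⟩ := hsurj g
    rw [imageAct_apply, hs.act_self]
  · obtain ⟨x, rfl⟩ := hsurj g
    obtain ⟨y, rfl⟩ := hsurj g'
    rw [eq_mul_inv_iff_mul_eq]
    ext1 t
    obtain ⟨z, rfl⟩ := hsurj t
    simp only [Equiv.Perm.mul_apply, imageAct_apply]
    exact congrArg _ (quandleAut_apply (hs.mem_quandleAut x) y z).symm

theorem sameCycle_map {α β : Type*} {f : Equiv.Perm α} {g : Equiv.Perm β} (F : α → β)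
    (hF : ∀ p, F (f p) = g (F p)) {p q : α} (h : f.SameCycle p q) :
    g.SameCycle (F p) (F q) := by
  have := sameCycle_invariant (F := fun t => g.SameCycle (F p) (F t))
    (fun t => by rw [hF, Equiv.Perm.sameCycle_apply_right]) h
  exact this.mp (Equiv.Perm.SameCycle.refl g _)

/-- In a connected quandle with more than one point, there are at least three different actions:
otherwise inner automorphisms would preserve actions, and connectedness would make them trivial. -/
theorem two_lt_card_range [Finite X] (hs : IsQuandle s) (hX : 1 < Nat.card X)
    (hconn : ∀ x y, connComp s x = connComp s y) : 2 < Nat.card (Set.range s) := by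
  rw [Nat.card_coe_set_eq]
  by_contra hle
  have hact : ∀ x y, s (s x y) = s y := by
    intro x y
    have hne : ∀ z, s x ≠ s y → s x ≠ s z → s y = s z := by
      intro z h1 h2
      by_contra h3
      exact hle ((Set.two_lt_ncard_iff (Set.toFinite _)).2
        ⟨s x, s y, s z, ⟨x, rfl⟩, ⟨y, rfl⟩, ⟨z, rfl⟩, h1, h2, h3⟩)
    by_cases h1 : s x = s y
    · rw [h1, hs.act_self]
    · refine (hne _ h1 fun h2 => h1 ?_).symm
      rw [hs.act_act, eq_mul_inv_iff_mul_eq, mul_right_inj] at h2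
      exact h2
  have hinv : ∀ g ∈ innerGroup s, ∀ y, s (g y) = s y := by
    intro g hg
    induction hg using Subgroup.closure_induction with
    | mem _ h => obtain ⟨x, rfl⟩ := h; exact hact x
    | one => exact fun _ => rfl
    | mul g g' _ _ h h' => exact fun y => (h _).trans (h' y)
    | inv g _ h =>
      intro y
      rw [← h (g⁻¹ y)]
      exact congrArg s (g.apply_symm_apply y)
  have hall : ∀ x y, s x = s y := fun x y => by
    obtain ⟨g, hg, rfl⟩ := connComp_eq_iff.1 (hconn x y)
    exact hinv g hg y
  have hone : innerGroup s ≤ ⊥ := by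
    refine (Subgroup.closure_le _).2 ?_
    rintro _ ⟨x, rfl⟩
    refine Subgroup.mem_bot.2 (Equiv.ext fun y => ?_)
    rw [hall x y, hs.act_self]
    rfl
  have : Nontrivial X := Finite.one_lt_card_iff_nontrivial.1 hX
  obtain ⟨x, y, hxy⟩ := exists_pair_ne X
  obtain ⟨g, hg, rfl⟩ := connComp_eq_iff.1 (hconn x y)
  rw [Subgroup.mem_bot.1 (hone hg)] at hxy
  exact hxy rfl

theorem isMinimalQuandle_imageAct [Finite X] (hs : IsQuandle s)
    (hcard : numOrbits (ofPerms s) = 2 * Nat.card X - 1) (hX : 1 < Nat.card X)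
    (hconn : ∀ x y, connComp s x = connComp s y) : IsMinimalQuandle (imageAct hs) := by
  have hsurj := Set.rangeFactorization_surjective (f := s)
  refine ⟨isQuandle_imageAct hs, fun g g' t hgg => ?_, fun g g' => ?_,
    two_lt_card_range hs hX hconn⟩
  · obtain ⟨x, rfl⟩ := hsurj g
    obtain ⟨y, rfl⟩ := hsurj g'
    obtain ⟨w, rfl⟩ := hsurj t
    obtain ⟨B⟩ := nonempty_representatives s w
    obtain ⟨z, -, h⟩ := B.exists_sameCycle_base hs hcard hconn (p := (x, y))
      (fun e => hgg (Subtype.ext e))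
    exact ⟨_, sameCycle_map (f := ofPerms s) (g := ofPerms (imageAct hs))
      (Prod.map (Set.rangeFactorization s) (Set.rangeFactorization s))
      (fun p : X × X => Prod.ext (imageAct_apply hs p.1 p.2).symm rfl) h⟩
  · obtain ⟨x, rfl⟩ := hsurj g
    obtain ⟨y, rfl⟩ := hsurj g'
    obtain ⟨g, hg, rfl⟩ := connComp_eq_iff.1 (hconn y x)
    have key : ∃ t ∈ quandleAut (imageAct hs), ∀ z,
        t (Set.rangeFactorization s z) = Set.rangeFactorization s (g z) := by
      induction hg using Subgroup.closure_induction with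
      | mem _ h =>
        obtain ⟨w, rfl⟩ := h
        exact ⟨_, (isQuandle_imageAct hs).mem_quandleAut _, imageAct_apply hs w⟩
      | one => exact ⟨1, one_mem _, fun _ => rfl⟩
      | mul g g' _ _ h h' =>
        obtain ⟨t, ht, e⟩ := h
        obtain ⟨t', ht', e'⟩ := h'
        exact ⟨t * t', mul_mem ht ht', fun z => by
          rw [Equiv.Perm.mul_apply, e', e, Equiv.Perm.mul_apply]⟩
      | inv g _ h =>
        obtain ⟨t, ht, e⟩ := h
        refine ⟨t⁻¹, inv_mem ht, fun z => ?_⟩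
        rw [Equiv.Perm.inv_eq_iff_eq, e]
        exact congrArg _ (g.apply_symm_apply z).symm
    exact key.imp fun t ht => ⟨ht.1, ht.2 x⟩

/-- A connected quandle with more than one point and `2 |X| - 1` orbits covers a dihedral quandle of
odd prime order, whose points are the different actions. -/
theorem exists_map_zmod [Finite X] (hs : IsQuandle s)
    (hcard : numOrbits (ofPerms s) = 2 * Nat.card X - 1) (hX : 1 < Nat.card X)
    (hconn : ∀ x y, connComp s x = connComp s y) :
    ∃ p : ℕ, p.Prime ∧ Odd p ∧ ∃ F : X → ZMod p, Function.Surjective F ∧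
      (∀ x y, F (s x y) = 2 * F x - F y) ∧ ∀ x y, F x = F y ↔ s x = s y := by
  have h := isMinimalQuandle_imageAct hs hcard hX hconn
  obtain ⟨f, hf⟩ := h.exists_equiv_zmod
  refine ⟨_, h.prime_card, h.odd_card, fun x => f (Set.rangeFactorization s x),
    f.surjective.comp Set.rangeFactorization_surjective, fun x y => ?_, fun x y => ?_⟩
  · exact (congrArg f (imageAct_apply hs x y).symm).trans (hf _ _)
  · rw [f.injective.eq_iff, Subtype.ext_iff]
    rfl

theorem ofPerms_sq_apply (hs : IsQuandle s) (x y : X) :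
    (ofPerms s ^ 2) (x, y) = ((s x * s y) x, (s x * s y) y) := by
  rw [pow_two, Equiv.Perm.mul_apply, ofPerms_apply, ofPerms_apply, hs.act_act]
  simp only [Equiv.Perm.mul_apply, hs.act_self]
  rw [Equiv.Perm.inv_eq_iff_eq.2 (hs.act_self x).symm]

theorem ofPerms_pow_two_mul_apply (hs : IsQuandle s) (x y : X) (k : ℕ) :
    (ofPerms s ^ (2 * k)) (x, y) = (((s x * s y) ^ k) x, ((s x * s y) ^ k) y) := by
  induction k with
  | zero => rfl
  | succ k ih =>
    have hm : s (((s x * s y) ^ k) x) * s (((s x * s y) ^ k) y) = s x * s y := by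
      have := hs.mul_eq_of_sameCycle (p := (x, y)) ⟨(2 * k : ℕ), ih⟩
      exact this.symm
    rw [mul_add, mul_one, add_comm, pow_add, Equiv.Perm.mul_apply, ih, ofPerms_sq_apply hs, hm,
      pow_succ']
    rfl

/-- A connected quandle with `2 |X| - 1` orbits is faithful.  All the permutations `s x` turn out to
be involutions, hence the product `c = s x * s y` has order `p`, and the orbit of `(x, y)`
contains at most two pairs with the same actions as `(x, y)`.  If two points had the same action,
there would be at least four. -/
theorem injective_of_connected [Finite X] (hs : IsQuandle s)
    (hcard : numOrbits (ofPerms s) = 2 * Nat.card X - 1) (hX : 1 < Nat.card X)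
    (hconn : ∀ x y, connComp s x = connComp s y) : Function.Injective s := by
  obtain ⟨p, hp, -, F, hFs, hF, hFi⟩ := exists_map_zmod hs hcard hX hconn
  have : Fact p.Prime := ⟨hp⟩
  have hsq : ∀ w, s w * s w = 1 := by
    intro w
    have hcomm : s w * s w ∈ Subgroup.centralizer (Set.range s) := by
      rw [Subgroup.mem_centralizer_iff]
      rintro _ ⟨z, rfl⟩
      have h1 := mul_mem (hs.mem_quandleAut w) (hs.mem_quandleAut w) z
      have h2 : s ((s w * s w) z) = s z := by
        rw [← hFi, Equiv.Perm.mul_apply, hF, hF]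
        ring
      rw [h2] at h1
      exact h1.symm
    rw [← Subgroup.centralizer_closure, Subgroup.mem_centralizer_iff] at hcomm
    ext1 z
    obtain ⟨g, hg, rfl⟩ := connComp_eq_iff.1 (hconn z w)
    have := congrArg (fun f : Equiv.Perm X => f w) (hcomm g hg)
    simp only [Equiv.Perm.mul_apply, hs.act_self] at this
    simp only [Equiv.Perm.mul_apply, ← this, Equiv.Perm.one_apply]
  intro x x' hxx
  by_contra hne
  obtain ⟨y, hy⟩ := hFs (F x + 1)
  have hxy : s x ≠ s y := fun e => by
    rw [← hFi, hy] at e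
    simp at e
  obtain ⟨g, hg, rfl⟩ := connComp_eq_iff.1 (hconn y x)
  have hgs : ∀ z, s (g z) = g * s z * g⁻¹ := fun z => by
    rw [eq_mul_inv_iff_mul_eq]
    exact (innerGroup_le hs hg z).symm
  have hyy : s (g x) = s (g x') := by rw [hgs, hgs, hxx]
  have hne' : g x ≠ g x' := g.injective.ne hne
  generalize g x = y at *
  generalize g x' = y' at *
  have horbit : ∀ k : ℕ, s ((ofPerms s ^ k) (x, y)).2 = (s x * s y) ^ k * s y ∧
      F ((ofPerms s ^ k) (x, y)).2 = F y - k ∧ F ((ofPerms s ^ k) (x, y)).1 = F y - k - 1 := by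
    intro k
    induction k with
    | zero => simp [hy]
    | succ k ih =>
      have hmul := hs.mul_eq_of_sameCycle (p := (x, y)) ⟨(k : ℕ), rfl⟩
      rw [zpow_natCast] at hmul
      obtain ⟨i1, i2, i3⟩ := ih
      rw [pow_succ', Equiv.Perm.mul_apply]
      generalize (ofPerms s ^ k) (x, y) = q at *
      change s q.1 = _ ∧ F q.1 = _ ∧ F (s q.1 q.2) = _
      refine ⟨?_, ?_, ?_⟩
      · rw [pow_succ', mul_assoc, ← i1, hmul, mul_assoc, hsq, mul_one]
      · rw [i3]
        push_cast
        ring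
      · rw [hF, i2, i3]
        push_cast
        ring
  have hcp : (s x * s y) ^ p = 1 := by
    have h1 : s ((ofPerms s ^ p) (x, y)).2 = s y := by
      rw [← hFi, (horbit p).2.1]
      simp
    rw [(horbit p).1] at h1
    exact mul_eq_right.1 h1
  have htwo : ∀ q : X × X, (ofPerms s).SameCycle (x, y) q → F q.2 = F y →
      q = (x, y) ∨ q = (ofPerms s ^ p) (x, y) := by
    intro q hq hF'
    obtain ⟨k, -, rfl⟩ := hq.exists_pow_eq'
    rw [(horbit k).2.1, sub_eq_self, ZMod.natCast_eq_zero_iff] at hF'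
    obtain ⟨m, rfl⟩ := hF'
    have hper : ∀ j : ℕ, (ofPerms s ^ (2 * (p * j))) (x, y) = (x, y) := fun j => by
      rw [ofPerms_pow_two_mul_apply hs, pow_mul, hcp, one_pow]
      rfl
    obtain ⟨j, rfl | rfl⟩ := m.even_or_odd'
    · left
      rw [mul_left_comm, hper]
    · right
      rw [show p * (2 * j + 1) = p + 2 * (p * j) by ring, pow_add, Equiv.Perm.mul_apply, hper]
  have h1 := htwo (x, y') (sameCycle_of_mul_eq hs hcard hconn hxy (hyy ▸ hxy) (by
    change s x * s y = s x * s y'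
    rw [hyy])) ((hFi _ _).2 hyy.symm)
  have h2 := htwo (x', y) (sameCycle_of_mul_eq hs hcard hconn hxy (hxx ▸ hxy) (by
    change s x * s y = s x' * s y
    rw [hxx])) rfl
  rcases h1 with h1 | h1
  · exact hne' (Prod.mk.inj h1).2.symm
  · rcases h2 with h2 | h2
    · exact hne (Prod.mk.inj h2).1.symm
    · exact hne (Prod.mk.inj (h1.trans h2.symm)).1

theorem dihedral_of_connected [Finite X] (hs : IsQuandle s)
    (hcard : numOrbits (ofPerms s) = 2 * Nat.card X - 1) (hX : 1 < Nat.card X)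
    (hconn : ∀ x y, connComp s x = connComp s y) :
    (Nat.card X).Prime ∧ Odd (Nat.card X) ∧ Iso (ofPerms s) (dihedral (Nat.card X)) := by
  obtain ⟨p, hp, hodd, F, hFs, hF, hFi⟩ := exists_map_zmod hs hcard hX hconn
  have hinj := injective_of_connected hs hcard hX hconn
  let f : X ≃ ZMod p := Equiv.ofBijective F ⟨fun x y e => hinj ((hFi x y).1 e), hFs⟩
  have hXp : Nat.card X = p := by rw [Nat.card_congr f, Nat.card_zmod]
  rw [hXp]
  exact ⟨hp, hodd, f, fun x y => Prod.ext (hF x y).symm rfl⟩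

end Connected

/-! ### Disconnected quandles with few orbits -/

section Disconnected

variable {X : Type*} {s : X → Equiv.Perm X}

theorem connComp_eq_or_eq [Finite X] (hs : IsQuandle s)
    (hcard : numOrbits (ofPerms s) = 2 * Nat.card X - 1) {x₀ x₁ : X}
    (h01 : connComp s x₀ ≠ connComp s x₁) (z : X) :
    connComp s z = connComp s x₀ ∨ connComp s z = connComp s x₁ := by
  by_contra! hz
  obtain ⟨B⟩ := nonempty_representatives s x₀
  obtain ⟨w, hw, h⟩ := B.exists_sameCycle hs hcard (p := (x₁, z))
    (fun e => hz.2 (congrArg (connComp s) e.symm))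
  have i2 := sameCycle_connComp h
  rcases B.pair_cases hw with ⟨-, e⟩ | ⟨-, -, -, e⟩ | ⟨-, -, -, e⟩ <;>
    simp only [e, B.connComp_ρ, B.connComp_b] at i2
  · have := sym2_same i2.symm
    exact hz.2 (this.2.trans this.1.symm)
  · have := sym2_same i2.symm
    exact hz.2 (this.2.trans this.1.symm)
  · rw [Sym2.eq_iff] at i2
    rcases i2 with ⟨e, -⟩ | ⟨-, e⟩
    · exact h01 e.symm
    · exact hz.1 e

/-- All pairs joining two given components lie in one orbit. -/
theorem sameCycle_of_connComp_ne [Finite X] (hs : IsQuandle s)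
    (hcard : numOrbits (ofPerms s) = 2 * Nat.card X - 1) {x y x' y' : X}
    (hxy : connComp s x ≠ connComp s y) (hx : connComp s x = connComp s x')
    (hy : connComp s y = connComp s y') : (ofPerms s).SameCycle (x, y) (x', y') := by
  obtain ⟨B⟩ := nonempty_representatives s x
  have key : ∀ u v, connComp s u = connComp s x → connComp s v = connComp s y →
      (ofPerms s).SameCycle (u, v) (x, B.b y) := by
    intro u v hu hv
    obtain ⟨w, hw, h⟩ := B.exists_sameCycle hs hcard (p := (u, v))
      (fun e => hxy (hu.symm.trans ((congrArg (connComp s) e).trans hv)))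
    have i2 := sameCycle_connComp h
    rcases B.pair_cases hw with ⟨-, e⟩ | ⟨-, -, -, e⟩ | ⟨-, hb, -, e⟩ <;>
      simp only [e, B.connComp_ρ, B.connComp_b, hu, hv] at i2
    · have := sym2_same i2.symm
      exact absurd (this.1.trans this.2.symm) hxy
    · have := sym2_same i2.symm
      exact absurd (this.1.trans this.2.symm) hxy
    · rw [e, ← hb, B.b_congr w y (sym2_left i2).symm] at h
      exact h
  exact (key x y rfl rfl).trans (key x' y' hx.symm hy.symm).symm

theorem act_eq_of_connComp_eq [Finite X] (hs : IsQuandle s)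
    (hcard : numOrbits (ofPerms s) = 2 * Nat.card X - 1) {x₀ x₁ : X}
    (h01 : connComp s x₀ ≠ connComp s x₁) {x y : X} (hxy : connComp s x = connComp s y) :
    s x = s y := by
  obtain ⟨z, hz⟩ : ∃ z, connComp s x ≠ connComp s z := by
    by_cases h : connComp s x = connComp s x₀
    · exact ⟨x₁, h ▸ h01⟩
    · exact ⟨x₀, h⟩
  exact mul_right_cancel
    (hs.mul_eq_of_sameCycle (sameCycle_of_connComp_ne hs hcard hz hxy rfl))

/-- The pairs of distinct elements of a component of a disconnected quandle all have the chosen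
representative as a member, so that the component has at most two elements. -/
theorem eq_or_eq_of_connComp_eq [Finite X] (hs : IsQuandle s)
    (hcard : numOrbits (ofPerms s) = 2 * Nat.card X - 1) {x₀ x₁ : X}
    (h01 : connComp s x₀ ≠ connComp s x₁) {x y z : X} (hxy : connComp s x = connComp s y)
    (hxz : connComp s x = connComp s z) (hne : x ≠ y) : z = x ∨ z = y := by
  obtain ⟨B⟩ := nonempty_representatives s x₀
  have hact : ∀ {u v}, connComp s u = connComp s v → s u = s v :=
    act_eq_of_connComp_eq hs hcard h01
  have key : ∀ u v, u ≠ v → connComp s u = connComp s x → connComp s v = connComp s x →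
      B.ρ x = u ∨ B.ρ x = v := by
    intro u v huv hu hv
    have hsuv : s u = s v := hact (hu.trans hv.symm)
    obtain ⟨w, hw, h⟩ := B.exists_sameCycle hs hcard (p := (u, v)) huv
    have i2 := sameCycle_connComp h
    have i3 := hs.sameCycle_fiber h
    rcases B.pair_cases hw with ⟨-, e⟩ | ⟨-, -, hb, e⟩ | ⟨-, -, hb, e⟩
    · have i4 := i3.2 hsuv
      simp only [e, B.connComp_ρ] at i2 i4
      have hwx : connComp s w = connComp s x := by
        rw [hu, hv] at i2
        exact (sym2_same i2).1
      rw [B.ρ_congr w x hwx (hact hwx), Sym2.eq_iff] at i4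
      exact (i4.imp And.right And.left).symm.imp Eq.symm Eq.symm
    · rw [e] at i3
      exact absurd (i3.1.1 hsuv) hb
    · simp only [e, hu, hv] at i2
      have := sym2_same i2
      exact absurd (this.1.trans this.2.symm) hb
  by_contra! hz
  have h1 := key x y hne rfl hxy.symm
  have h2 := key x z hz.1.symm rfl hxz.symm
  have h3 := key y z hz.2.symm hxy.symm hxz.symm
  rcases h1 with h1 | h1 <;> rcases h2 with h2 | h2 <;> rcases h3 with h3 | h3 <;>
    simp_all

/-- If a component has two elements, these are interchanged by the elements of the other
component, since the elements of the component itself act trivially on it. -/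
theorem act_eq_other [Finite X] (hs : IsQuandle s)
    (hcard : numOrbits (ofPerms s) = 2 * Nat.card X - 1) {x x' y : X}
    (hxy : connComp s x ≠ connComp s y) (hx : connComp s x = connComp s x') (hne : x ≠ x') :
    s y x = x' := by
  have hact : ∀ {u v}, connComp s u = connComp s v → s u = s v :=
    act_eq_of_connComp_eq hs hcard hxy
  rcases eq_or_eq_of_connComp_eq hs hcard hxy hx (connComp_act (s := s) y x).symm hne with h | h
  · exfalso
    have hle : innerGroup s ≤ MulAction.stabilizer (Equiv.Perm X) x := by
      refine (Subgroup.closure_le _).2 ?_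
      rintro _ ⟨z, rfl⟩
      rcases connComp_eq_or_eq hs hcard hxy z with hz | hz
      · rw [hact hz]
        exact hs.act_self x
      · rw [hact hz]
        exact h
    obtain ⟨g, hg, rfl⟩ := connComp_eq_iff.1 hx.symm
    exact hne (hle hg).symm
  · exact h

theorem sameCycle_closed {α : Type*} [Finite α] {f : Equiv.Perm α} {P : α → Prop}
    (hP : ∀ p, P p → P (f p)) {p q : α} (h : f.SameCycle p q) (hp : P p) : P q := by
  obtain ⟨k, -, rfl⟩ := h.exists_pow_eq'
  induction k with
  | zero => exact hp
  | succ k ih =>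
    rw [pow_succ', Equiv.Perm.mul_apply]
    exact hP _ (ih ⟨(k : ℕ), rfl⟩)

/-- Two components with two elements each would give two orbits of four pairs joining them. -/
theorem component_subsingleton [Finite X] (hs : IsQuandle s)
    (hcard : numOrbits (ofPerms s) = 2 * Nat.card X - 1) {x x' y y' : X}
    (hxy : connComp s x ≠ connComp s y) (hx : connComp s x = connComp s x') (hne : x ≠ x')
    (hy : connComp s y = connComp s y') : y = y' := by
  by_contra hne'
  have hact : ∀ {u v}, connComp s u = connComp s v → s u = s v :=
    act_eq_of_connComp_eq hs hcard hxy
  have h1 : s y x = x' := act_eq_other hs hcard hxy hx hne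
  have h2 : s y x' = x := act_eq_other hs hcard (hx ▸ hxy) hx.symm (Ne.symm hne)
  have h3 : s x y = y' := act_eq_other hs hcard (Ne.symm hxy) hy hne'
  have h4 : s x y' = y := act_eq_other hs hcard (hy ▸ Ne.symm hxy) hy.symm (Ne.symm hne')
  have hsx := hact hx
  have hsy := hact hy
  have := sameCycle_closed (f := ofPerms s)
    (P := fun q => q = (x, y) ∨ q = (y', x) ∨ q = (x', y') ∨ q = (y, x'))
    (by
      rintro _ (rfl | rfl | rfl | rfl)
      · simp [ofPerms_apply, h3]
      · simp [ofPerms_apply, ← hsy, h1]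
      · simp [ofPerms_apply, ← hsx, h4]
      · simp [ofPerms_apply, h2])
    (sameCycle_of_connComp_ne hs hcard hxy hx rfl) (Or.inl rfl)
  simp only [Prod.mk.injEq] at this
  rcases this with ⟨h, -⟩ | ⟨h, -⟩ | ⟨-, h⟩ | ⟨h, -⟩
  · exact hne h.symm
  · exact hxy (hx.trans ((congrArg (connComp s) h).trans hy.symm))
  · exact hne' h
  · exact hxy (hx.trans (congrArg (connComp s) h))

theorem iso_threePoint {a b c : X} (hab : a ≠ b) (hac : a ≠ c) (hbc : b ≠ c)
    (hall : ∀ x, x = a ∨ x = b ∨ x = c) (ha : ∀ x, s a x = x) (hb : ∀ x, s b x = x)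
    (hc₁ : s c a = b) (hc₂ : s c b = a) (hc₃ : s c c = c) :
    Nat.card X = 3 ∧ Iso (ofPerms s) threePoint := by
  let e : Fin 3 ≃ X := Equiv.ofBijective ![a, b, c] ⟨by
    intro i j h
    fin_cases i <;> fin_cases j <;> simp_all, by
    intro x
    rcases hall x with rfl | rfl | rfl
    exacts [⟨0, rfl⟩, ⟨1, rfl⟩, ⟨2, rfl⟩]⟩
  have e0 : e 0 = a := rfl
  have e1 : e 1 = b := rfl
  have e2 : e 2 = c := rfl
  refine ⟨by rw [← Nat.card_congr e, Nat.card_fin], e.symm, fun x y => ?_⟩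
  obtain ⟨i, rfl⟩ := e.surjective x
  obtain ⟨j, rfl⟩ := e.surjective y
  have key : s (e i) (e j) = e ((![1, 1, Equiv.swap 0 1] : Fin 3 → Equiv.Perm (Fin 3)) i j) := by
    fin_cases i
    · exact ha _
    · exact hb _
    · fin_cases j
      · exact hc₁
      · exact hc₂
      · exact hc₃
  rw [e.symm_apply_apply, e.symm_apply_apply, ofPerms_apply, key]
  simp [threePoint, ofPerms]

theorem threePoint_of_ne [Finite X] (hs : IsQuandle s)
    (hcard : numOrbits (ofPerms s) = 2 * Nat.card X - 1) {x x' y : X}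
    (hxy : connComp s x ≠ connComp s y) (hx : connComp s x = connComp s x') (hne : x ≠ x') :
    Nat.card X = 3 ∧ Iso (ofPerms s) threePoint := by
  have hact : ∀ {u v}, connComp s u = connComp s v → s u = s v :=
    act_eq_of_connComp_eq hs hcard hxy
  have hall : ∀ z, z = x ∨ z = x' ∨ z = y := by
    intro z
    rcases connComp_eq_or_eq hs hcard hxy z with hz | hz
    · rw [← or_assoc]
      exact .inl (eq_or_eq_of_connComp_eq hs hcard hxy hx hz.symm hne)
    · exact .inr (.inr (component_subsingleton hs hcard hxy hx hne hz.symm).symm)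
  have hsx : ∀ z, s x z = z := by
    intro z
    rcases hall z with rfl | rfl | rfl
    · exact hs.act_self _
    · rw [hact hx, hs.act_self]
    · exact (component_subsingleton hs hcard hxy hx hne (connComp_act x z).symm).symm
  refine iso_threePoint hne (fun e => hxy (congrArg _ e)) (fun e => hxy (hx.trans (congrArg _ e)))
    hall hsx (hact hx ▸ hsx) (act_eq_other hs hcard hxy hx hne)
    (act_eq_other hs hcard (hx ▸ hxy) hx.symm (Ne.symm hne)) (hs.act_self y)

theorem trivial_or_threePoint_of_disconnected [Finite X] (hs : IsQuandle s)
    (hcard : numOrbits (ofPerms s) = 2 * Nat.card X - 1) {x y : X}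
    (hxy : connComp s x ≠ connComp s y) :
    (Nat.card X = 2 ∧ ofPerms s = trivialSet X) ∨
      (Nat.card X = 3 ∧ Iso (ofPerms s) threePoint) := by
  by_cases hx : ∃ x', connComp s x = connComp s x' ∧ x ≠ x'
  · obtain ⟨x', h, hne⟩ := hx
    exact .inr (threePoint_of_ne hs hcard hxy h hne)
  by_cases hy : ∃ y', connComp s y = connComp s y' ∧ y ≠ y'
  · obtain ⟨y', h, hne⟩ := hy
    exact .inr (threePoint_of_ne hs hcard (Ne.symm hxy) h hne)
  push Not at hx hy
  have hne : x ≠ y := fun e => hxy (congrArg _ e)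
  have hall : ∀ z, z = x ∨ z = y := fun z =>
    (connComp_eq_or_eq hs hcard hxy z).imp (fun h => (hx z h.symm).symm)
      (fun h => (hy z h.symm).symm)
  refine .inl ⟨?_, ?_⟩
  · have : (Set.univ : Set X) = {x, y} := by
      ext z
      simpa using hall z
    rw [← Set.ncard_univ, this, Set.ncard_pair hne]
  · have hact : ∀ u v, s u v = v := by
      intro u v
      have h := (connComp_act (s := s) u v).symm
      rcases hall v with rfl | rfl
      · exact (hx _ h).symm
      · exact (hy _ h).symm
    ext1 p
    change (s p.1 p.2, p.1) = (p.2, p.1)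
    rw [hact]

end Disconnected

/-! ### The classification -/

section Classification

/-- The left translations `σ'_x` of the derived solution, as permutations of the finite set `X`. -/
noncomputable def derivedPerm {X : Type u} [Finite X] (r : Equiv.Perm (X × X))
    (h : IsNondegenerate r) (x : X) : Equiv.Perm X :=
  Equiv.ofBijective (derivedAct r h x) (Finite.injective_iff_bijective.1 (derivedAct_injective h x))

theorem derived_eq_ofPerms {X : Type u} [Finite X] {r : Equiv.Perm (X × X)}
    (h : IsNondegenerate r) : derived r h = ofPerms (derivedPerm r h) :=
  Equiv.ext fun p => derived_eq h p.1 p.2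

theorem isQuandle_derivedPerm {X : Type u} [Finite X] {r : Equiv.Perm (X × X)}
    (hb : IsBraided r) (h : IsNondegenerate r) (hsf : IsSquareFree r) :
    IsQuandle (derivedPerm r h) := by
  refine ⟨derivedAct_self h hsf, fun x y => ?_⟩
  rw [eq_mul_inv_iff_mul_eq]
  ext1 z
  exact (derivedAct_derivedAct hb h x y z).symm

/-- The classification of finite quandles with `2 |X| - 1` orbits on pairs. -/
theorem classification {X : Type u} [Finite X] {s : X → Equiv.Perm X} (hs : IsQuandle s)
    (hX : 1 < Nat.card X) (hcard : numOrbits (ofPerms s) = 2 * Nat.card X - 1) :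
    ((Nat.card X).Prime ∧ Odd (Nat.card X) ∧ Iso (ofPerms s) (dihedral (Nat.card X))) ∨
      (Nat.card X = 2 ∧ ofPerms s = trivialSet X) ∨
      (Nat.card X = 3 ∧ Iso (ofPerms s) threePoint) := by
  by_cases hconn : ∀ x y, connComp s x = connComp s y
  · exact .inl (dihedral_of_connected hs hcard hX hconn)
  · push Not at hconn
    obtain ⟨x, y, hxy⟩ := hconn
    exact .inr (trivial_or_threePoint_of_disconnected hs hcard hxy)

end Classification

end QuadraticSet

theorem mainTheorem1 {X : Type u} [Finite X] (r : Equiv.Perm (X × X))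
    (hbraided : QuadraticSet.IsBraided r) (hnd : QuadraticSet.IsNondegenerate r)
    (hsf : QuadraticSet.IsSquareFree r) (hX : 1 < Nat.card X)
    (horb : QuadraticSet.numOrbits r = 2 * Nat.card X - 1) :
    (Nat.card X).Prime ∧
    (((Nat.card X).Prime ∧ Odd (Nat.card X) ∧
        QuadraticSet.Iso (QuadraticSet.derived r hnd) (QuadraticSet.dihedral (Nat.card X))) ∨
      (Nat.card X = 2 ∧ QuadraticSet.derived r hnd = QuadraticSet.trivialSet X) ∨
      QuadraticSet.Iso (QuadraticSet.derived r hnd) QuadraticSet.threePoint) ∧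
    ∀ (K : Type v) [Field K] (m : ℕ),
      Module.rank K (QuadraticSet.component K r m) =
        Module.rank K (QuadraticSet.component K (QuadraticSet.derived r hnd) m) := by
  have hcard := horb
  rw [← QuadraticSet.numOrbits_derived hnd, QuadraticSet.derived_eq_ofPerms hnd] at hcard
  have key := QuadraticSet.classification
    (QuadraticSet.isQuandle_derivedPerm hbraided hnd hsf) hX hcard
  rw [← QuadraticSet.derived_eq_ofPerms hnd] at key
  refine ⟨?_, key.imp_right (Or.imp_right And.right), fun K _ m =>
    QuadraticSet.rank_component_derived K hbraided hnd m⟩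
  rcases key with h | h | h
  · exact h.1
  · rw [h.1]
    exact Nat.prime_two
  · rw [h.1]
    exact Nat.prime_three
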